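/- Let $R$ be an associative ring with $1$. "Module" means unital right $R$-module. A module $M$ is flat if $M\otimes_R -$ preserves injectivity of homomorphisms of left $R$-modules, and Mittag-Leffler if the canonical map $M\otimes_R\prod_{i\in I}Q_i\to\prod_{i\in I}(M\otimes_R Q_i)$ is injective for every family $(Q_i)_{i\in I}$ of left $R$-modules. Let $\mathcal F$ be the class of all flat modules and $\mathcal D$ the class of all flat Mittag-Leffler modules. For a class $\mathcal C$ of modules put $${}^\perp\mathcal C=\{M : \mathrm{Ext}^1_R(M,C)=0 \text{ for all } C\in\mathcal C\},\qquad \mathcal C^\perp=\{N : \mathrm{Ext}^1_R(C,N)=0 \text{ for all } C\in\mathcal C\}.$$ A class $\mathcal A$ is closed under products if the direct product of every family (indexed by a set) of modules from $\mathcal A$ is in $\mathcal A$. A module $M$ is a transfinite extension of modules in $\mathcal A$ if there are an ordinal $\lambda$ and an increasing chain $(M_\alpha\mid\alpha\le\lambda)$ of submodules of $M$ with $M_0=0$, $M_\lambda=M$, $M_\alpha=\bigcup_{\beta<\alpha}M_\beta$ for every limit ordinal $\alpha\le\lambda$, and $M_{\alpha+1}/M_\alpha$ isomorphic to an element of $\mathcal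 A$ for every $\alpha<\lambda$; $\mathcal A$ is closed under transfinite extensions if it contains every transfinite extension of modules in $\mathcal A$. The ring $R$ is right perfect if $R/J$ is semisimple and $J$ is right T-nilpotent, where $J$ is the Jacobson radical; right T-nilpotent means that for every sequence $a_0,a_1,\dots$ in $J$ there is $n$ with $a_{n-1}\cdots a_1a_0=0$. (i) If $R$ is not right perfect and $\mathcal D$ is closed under products, then $\mathcal D$ is closed under transfinite extensions, but $\mathcal D$ is not of the form ${}^\perp\mathcal C$ for any class $\mathcal C$ of modules. Both hypotheses hold, for example, whenever $R$ is left Noetherian and not left Artinian. (ii) If $R$ is countable and $\mathcal D$ is closed under products, then ${}^\perp(\mathcal D^\perp)=\mathcal F$. Both hypotheses hold, for example, whenever $R$ is countable and left Noetherian; indeed $\mathcal D$ is closed under products for every left Noetherian ring $R$. -/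

import Mathlib

open CategoryTheory

universe u

section TensorProduct

open scoped TensorProduct

/-- The relations `(m r) ⊗ n = m ⊗ (r n)`. A right `R`-module is a module over `Rᵐᵒᵖ`,
and `m r` is written `MulOpposite.op r • m`. -/
def balancingRelations (R M N : Type*) [Ring R] [AddCommGroup M] [Module Rᵐᵒᵖ M]
    [AddCommGroup N] [Module R N] : AddSubgroup (M ⊗[ℤ] N) :=
  AddSubgroup.closure
    {t | ∃ (m : M) (r : R) (n : N), t = (MulOpposite.op r • m) ⊗ₜ[ℤ] n - m ⊗ₜ[ℤ] (r • n)}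

/-- The tensor product `M ⊗_R N` of a right `R`-module `M` and a left `R`-module `N` over a
possibly noncommutative ring `R`, as an abelian group. -/
abbrev BalancedTensor (R M N : Type*) [Ring R] [AddCommGroup M] [Module Rᵐᵒᵖ M]
    [AddCommGroup N] [Module R N] : Type _ :=
  (M ⊗[ℤ] N) ⧸ balancingRelations R M N

/-- The homomorphism `M ⊗_R f : M ⊗_R N → M ⊗_R N'` induced by a homomorphism `f : N → N'` of
left `R`-modules; it sends `m ⊗ n` to `m ⊗ f n`. -/
def BalancedTensor.map (R M : Type*) {N N' : Type*} [Ring R] [AddCommGroup M] [Module Rᵐᵒᵖ M]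
    [AddCommGroup N] [Module R N] [AddCommGroup N'] [Module R N'] (f : N →ₗ[R] N') :
    BalancedTensor R M N →+ BalancedTensor R M N' :=
  QuotientAddGroup.map _ _
    (LinearMap.lTensor M f.toAddMonoidHom.toIntLinearMap).toAddMonoidHom (by
      refine (AddSubgroup.closure_le _).2 ?_
      rintro _ ⟨m, r, n, rfl⟩
      refine AddSubgroup.subset_closure ⟨m, r, f n, ?_⟩
      rw [map_sub, ← f.map_smul]
      rfl)

/-- The canonical map `ρ : M ⊗_R ∏ Q_i → ∏ (M ⊗_R Q_i)`, `m ⊗ (q_i)_i ↦ (m ⊗ q_i)_i`. -/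
def BalancedTensor.toPi (R M : Type*) [Ring R] [AddCommGroup M] [Module Rᵐᵒᵖ M]
    {I : Type*} (Q : I → Type*) [∀ i, AddCommGroup (Q i)] [∀ i, Module R (Q i)] :
    BalancedTensor R M (∀ i, Q i) →+ ∀ i, BalancedTensor R M (Q i) :=
  AddMonoidHom.pi fun i =>
    BalancedTensor.map R M (LinearMap.proj i : (∀ i, Q i) →ₗ[R] Q i)

end TensorProduct

/-- Classes of right `R`-modules. -/
abbrev RightModuleClass (R : Type u) [Ring R] := ObjectProperty (ModuleCat.{u} Rᵐᵒᵖ)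

section Classes

variable (R : Type u) [Ring R]

/-- The class `F` of flat right `R`-modules: `M ⊗_R -` preserves injectivity. -/
def flatModules : RightModuleClass R := fun M =>
  ∀ (N N' : Type u) [AddCommGroup N] [Module R N] [AddCommGroup N'] [Module R N']
    (f : N →ₗ[R] N'), Function.Injective f → Function.Injective (BalancedTensor.map R M f)

/-- The class of Mittag-Leffler right `R`-modules. -/
def mittagLefflerModules : RightModuleClass R := fun M =>
  ∀ (I : Type u) (Q : I → Type u) [∀ i, AddCommGroup (Q i)] [∀ i, Module R (Q i)],
    Function.Injective (BalancedTensor.toPi R M Q)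

/-- The class `D` of flat Mittag-Leffler right `R`-modules. -/
def flatMittagLefflerModules : RightModuleClass R := fun M =>
  flatModules R M ∧ mittagLefflerModules R M

variable {R}

/-- `⊥C`: the modules `M` with `Ext¹(M, N) = 0` for all `N` in `C`. -/
def leftExtOrthogonal (C : RightModuleClass R) : RightModuleClass R := fun M =>
  ∀ N : ModuleCat.{u} Rᵐᵒᵖ, C N → Subsingleton (Abelian.Ext M N 1)

/-- `C⊥`: the modules `N` with `Ext¹(M, N) = 0` for all `M` in `C`. -/
def rightExtOrthogonal (C : RightModuleClass R) : RightModuleClass R := fun N =>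
  ∀ M : ModuleCat.{u} Rᵐᵒᵖ, C M → Subsingleton (Abelian.Ext M N 1)

/-- Closure under direct products of arbitrary families. -/
def ClosedUnderProducts (A : RightModuleClass R) : Prop :=
  ∀ (I : Type u) (M : I → ModuleCat.{u} Rᵐᵒᵖ), (∀ i, A (M i)) →
    A (ModuleCat.of Rᵐᵒᵖ (∀ i, M i))

/-- A filtration `(F α ∣ α ≤ l)` of the module `M`: an increasing continuous chain of submodules
from `0` to `M`. The values of `F` at ordinals above `l` are irrelevant. -/
structure IsContinuousFiltration (M : ModuleCat.{u} Rᵐᵒᵖ) (l : Ordinal.{u})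
    (F : Ordinal.{u} → Submodule Rᵐᵒᵖ M) : Prop where
  mono : ∀ α β, α ≤ β → β ≤ l → F α ≤ F β
  zero : F 0 = ⊥
  last : F l = ⊤
  limit : ∀ α, α ≤ l → Order.IsSuccLimit α → (F α : Set M) = ⋃ β ∈ Set.Iio α, (F β : Set M)

/-- `M` is a transfinite extension of modules in `A`: it has a filtration each of whose
consecutive factors `F (α + 1) / F α` is isomorphic to an element of `A`. -/
def IsTransfiniteExtension (A : RightModuleClass R) (M : ModuleCat.{u} Rᵐᵒᵖ) : Prop :=
  ∃ (l : Ordinal.{u}) (F : Ordinal.{u} → Submodule Rᵐᵒᵖ M), IsContinuousFiltration M l F ∧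
    ∀ α, α < l → ∃ X : ModuleCat.{u} Rᵐᵒᵖ, A X ∧
      Nonempty ((F (α + 1) ⧸ (F α).submoduleOf (F (α + 1))) ≃ₗ[Rᵐᵒᵖ] X)

/-- Closure under transfinite extensions. -/
def ClosedUnderTransfiniteExtensions (A : RightModuleClass R) : Prop :=
  ∀ M : ModuleCat.{u} Rᵐᵒᵖ, IsTransfiniteExtension A M → A M

end Classes

/-- The product `a (n - 1) * ⋯ * a 1 * a 0`, in this order. -/
def descendingProd {R : Type*} [Ring R] (a : ℕ → R) : ℕ → R
  | 0 => 1
  | n + 1 => a n * descendingProd a n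

/-- `R` is right perfect: its Jacobson radical `J` is right T-nilpotent and `R / J` is
semisimple. -/
structure IsRightPerfect (R : Type*) [Ring R] : Prop where
  isSemisimpleRing : IsSemisimpleRing (R ⧸ Ring.jacobson R)
  rightTNilpotent : ∀ a : ℕ → R, (∀ n, a n ∈ Ring.jacobson R) → ∃ n, descendingProd a n = 0

/-!
A tensor `m ⊗ n` involves finitely many elements, and a flat Mittag-Leffler quotient splits off
purely, so being flat Mittag-Leffler passes through continuous filtrations.

For a sequence `f` of endomorphisms of a free module `E`, gluing copies of the telescope of `f`
along the nodes of the tree of finite sequences in `κ` gives a flat Mittag-Leffler module. If some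
`g : E^(ℕ) → C` does not extend along the telescope map, then `Ext¹(TreeModule κ f, C) = 0` would
produce `2^(κ^ℕ)` distinct families of homomorphisms indexed by the nodes, which is absurd for a
strong limit cardinal `κ` of countable cofinality. So every countable direct limit of copies of `E`
belongs to `⊥(D⊥)`. Applied to the Bass modules, the limits of `R → R → ⋯` along left
multiplications by `a₀, a₁, …`: if `D = ⊥C` then Bass modules are Mittag-Leffler, hence the chains
`R aₙ₋₁ ⋯ a₀` of left ideals stabilize, and `R` is right perfect.

Over a countable ring, a countable flat module is such a direct limit of copies of a free module,
and any element of a flat module lies in a countable pure submodule, so by Zorn's lemma every flat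
module is in `⊥(D⊥)`. Conversely, `D⊥` contains the character modules of left modules, and the
modules `M` with `Ext¹(M, Q⁺) = 0` for all `Q` are flat.

Over a left Noetherian ring, a tensor lives in `M ⊗ N₀` with `N₀` finitely presented, and tensoring
with `N₀` commutes with products; moreover a right T-nilpotent ideal is nilpotent, so a right
perfect left Noetherian ring is semiprimary, hence left Artinian.
-/

theorem exact_quotientAddGroupMap {A B C : Type*} [AddCommGroup A] [AddCommGroup B]
    [AddCommGroup C] {X : AddSubgroup A} {Y : AddSubgroup B} {Z : AddSubgroup C} {f : A →+ B}
    {g : B →+ C} (hf : X ≤ Y.comap f) (hg : Y ≤ Z.comap g) (hfg : Function.Exact f g)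
    (hZ : Z ≤ Y.map g) :
    Function.Exact (QuotientAddGroup.map X Y f hf) (QuotientAddGroup.map Y Z g hg) := by
  intro z
  obtain ⟨b, rfl⟩ := QuotientAddGroup.mk_surjective z
  constructor
  · intro hb
    obtain ⟨y, hy, hyb⟩ := hZ ((QuotientAddGroup.eq_zero_iff _).1 hb)
    obtain ⟨a, ha⟩ := (hfg (b - y)).1 (by rw [map_sub, hyb, sub_self])
    exact ⟨a, QuotientAddGroup.eq_iff_sub_mem.2 (by simpa [ha] using hy)⟩
  · rintro ⟨w, hw⟩
    obtain ⟨a, rfl⟩ := QuotientAddGroup.mk_surjective w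
    rw [← hw, QuotientAddGroup.map_mk, QuotientAddGroup.map_mk, hfg.apply_apply_eq_zero]
    rfl

namespace BalancedTensor

open scoped TensorProduct

section Basic

variable {R M M' M'' N N' N'' A : Type*} [Ring R]
  [AddCommGroup M] [Module Rᵐᵒᵖ M] [AddCommGroup M'] [Module Rᵐᵒᵖ M']
  [AddCommGroup M''] [Module Rᵐᵒᵖ M'']
  [AddCommGroup N] [Module R N] [AddCommGroup N'] [Module R N'] [AddCommGroup N''] [Module R N'']
  [AddCommGroup A]

/-- The pure tensor `m ⊗ n`. -/
def tmul (R : Type*) {M N : Type*} [Ring R] [AddCommGroup M] [Module Rᵐᵒᵖ M]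
    [AddCommGroup N] [Module R N] (m : M) (n : N) : BalancedTensor R M N :=
  QuotientAddGroup.mk (m ⊗ₜ[ℤ] n)

/-- The biadditive map `(m, n) ↦ m ⊗ n`. -/
def tmulHom (R M N : Type*) [Ring R] [AddCommGroup M] [Module Rᵐᵒᵖ M]
    [AddCommGroup N] [Module R N] : M →+ N →+ BalancedTensor R M N :=
  AddMonoidHom.mk' (fun m => AddMonoidHom.mk' (tmul R m) fun n n' =>
    congrArg QuotientAddGroup.mk (TensorProduct.tmul_add m n n')) fun m m' =>
    AddMonoidHom.ext fun n => congrArg QuotientAddGroup.mk (TensorProduct.add_tmul m m' n)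

@[simp] theorem tmulHom_apply (m : M) (n : N) : tmulHom R M N m n = tmul R m n := rfl

theorem add_tmul (m m' : M) (n : N) : tmul R (m + m') n = tmul R m n + tmul R m' n :=
  DFunLike.congr_fun (map_add (tmulHom R M N) m m') n

theorem tmul_add (m : M) (n n' : N) : tmul R m (n + n') = tmul R m n + tmul R m n' :=
  (tmulHom R M N m).map_add n n'

theorem smul_tmul (m : M) (r : R) (n : N) :
    tmul R (MulOpposite.op r • m) n = tmul R m (r • n) :=
  QuotientAddGroup.eq_iff_sub_mem.2 (AddSubgroup.subset_closure ⟨m, r, n, rfl⟩)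

@[simp] theorem zero_tmul (n : N) : tmul R (0 : M) n = 0 :=
  ((tmulHom R M N).flip n).map_zero

@[simp] theorem tmul_zero (m : M) : tmul R m (0 : N) = 0 :=
  (tmulHom R M N m).map_zero

theorem sum_tmul {ι : Type*} (s : Finset ι) (m : ι → M) (n : N) :
    tmul R (∑ i ∈ s, m i) n = ∑ i ∈ s, tmul R (m i) n :=
  map_sum ((tmulHom R M N).flip n) m s

@[elab_as_elim]
theorem induction_on {p : BalancedTensor R M N → Prop} (z : BalancedTensor R M N)
    (zero : p 0) (tmul : ∀ m n, p (tmul R m n)) (add : ∀ x y, p x → p y → p (x + y)) : p z := by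
  obtain ⟨t, rfl⟩ := QuotientAddGroup.mk_surjective z
  induction t using TensorProduct.induction_on with
  | zero => exact zero
  | tmul m n => exact tmul m n
  | add x y hx hy => exact add _ _ hx hy

theorem exists_eq_sum_tmul (z : BalancedTensor R M N) :
    ∃ (n : ℕ) (x : Fin n → M) (y : Fin n → N), z = ∑ i, tmul R (x i) (y i) := by
  induction z using induction_on with
  | zero => exact ⟨0, Fin.elim0, Fin.elim0, by simp⟩
  | tmul m n => exact ⟨1, fun _ => m, fun _ => n, by simp⟩
  | add a b ha hb =>
    obtain ⟨n, x, y, rfl⟩ := ha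
    obtain ⟨n', x', y', rfl⟩ := hb
    exact ⟨n + n', Fin.append x x', Fin.append y y', by simp [Fin.sum_univ_add]⟩

/-- The additive map out of `M ⊗_R N` given by a balanced biadditive map. -/
def lift (φ : M →+ N →+ A)
    (h : ∀ m (r : R) n, φ (MulOpposite.op r • m) n = φ m (r • n)) : BalancedTensor R M N →+ A :=
  QuotientAddGroup.lift _ (TensorProduct.liftAddHom φ fun r m n => by simp) (by
    refine (AddSubgroup.closure_le _).2 ?_
    rintro _ ⟨m, r, n, rfl⟩
    simp [h, AddMonoidHom.mem_ker])

@[simp] theorem lift_tmul (φ : M →+ N →+ A)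
    (h : ∀ m (r : R) n, φ (MulOpposite.op r • m) n = φ m (r • n)) (m : M) (n : N) :
    lift φ h (tmul R m n) = φ m n := rfl

theorem hom_ext {f g : BalancedTensor R M N →+ A}
    (h : ∀ m n, f (tmul R m n) = g (tmul R m n)) : f = g := by
  refine DFunLike.ext _ _ fun z => ?_
  induction z using induction_on with
  | zero => simp only [map_zero]
  | tmul m n => exact h m n
  | add x y hx hy => simp only [map_add, hx, hy]

@[simp] theorem map_tmul (f : N →ₗ[R] N') (m : M) (n : N) :
    map R M f (tmul R m n) = tmul R m (f n) := rfl

/-- The homomorphism `g ⊗_R N : M ⊗_R N → M' ⊗_R N` induced by a homomorphism `g` of right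
modules. -/
def mapLeft (N : Type*) [AddCommGroup N] [Module R N] (g : M →ₗ[Rᵐᵒᵖ] M') :
    BalancedTensor R M N →+ BalancedTensor R M' N :=
  QuotientAddGroup.map _ _
    (LinearMap.rTensor N g.toAddMonoidHom.toIntLinearMap).toAddMonoidHom (by
      refine (AddSubgroup.closure_le _).2 ?_
      rintro _ ⟨m, r, n, rfl⟩
      refine AddSubgroup.subset_closure ⟨g m, r, n, ?_⟩
      rw [map_sub, ← g.map_smul]
      rfl)

@[simp] theorem mapLeft_tmul (g : M →ₗ[Rᵐᵒᵖ] M') (m : M) (n : N) :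
    mapLeft N g (tmul R m n) = tmul R (g m) n := rfl

theorem mapLeft_map (g : M →ₗ[Rᵐᵒᵖ] M') (f : N →ₗ[R] N') (z : BalancedTensor R M N) :
    mapLeft N' g (map R M f z) = map R M' f (mapLeft N g z) :=
  DFunLike.congr_fun (hom_ext (f := (mapLeft N' g).comp (map R M f))
    (g := (map R M' f).comp (mapLeft N g)) fun _ _ => rfl) z

theorem map_map (f : N →ₗ[R] N') (g : N' →ₗ[R] N'') (z : BalancedTensor R M N) :
    map R M g (map R M f z) = map R M (g ∘ₗ f) z :=
  DFunLike.congr_fun (hom_ext (f := (map R M g).comp (map R M f))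
    (g := map R M (g ∘ₗ f)) fun _ _ => rfl) z

theorem mapLeft_mapLeft (f : M →ₗ[Rᵐᵒᵖ] M') (g : M' →ₗ[Rᵐᵒᵖ] M'') (z : BalancedTensor R M N) :
    mapLeft N g (mapLeft N f z) = mapLeft N (g ∘ₗ f) z :=
  DFunLike.congr_fun (hom_ext (f := (mapLeft N g).comp (mapLeft N f))
    (g := mapLeft N (g ∘ₗ f)) fun _ _ => rfl) z

theorem mapLeft_id (z : BalancedTensor R M N) : mapLeft N LinearMap.id z = z :=
  DFunLike.congr_fun (hom_ext (f := mapLeft N (LinearMap.id : M →ₗ[Rᵐᵒᵖ] M))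
    (g := AddMonoidHom.id _) fun _ _ => rfl) z

theorem toPi_apply {I : Type*} {Q : I → Type*} [∀ i, AddCommGroup (Q i)] [∀ i, Module R (Q i)]
    (z : BalancedTensor R M (∀ i, Q i)) (i : I) :
    toPi R M Q z i = map R M (LinearMap.proj i) z := rfl

theorem map_surjective {p : N →ₗ[R] N'} (hp : Function.Surjective p) :
    Function.Surjective (map R M p) :=
  QuotientAddGroup.map_surjective_of_surjective _ _ _
    (QuotientAddGroup.mk_surjective.comp (LinearMap.lTensor_surjective M hp)) _

theorem mapLeft_surjective {p : M →ₗ[Rᵐᵒᵖ] M'} (hp : Function.Surjective p) :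
    Function.Surjective (mapLeft N p) :=
  QuotientAddGroup.map_surjective_of_surjective _ _ _
    (QuotientAddGroup.mk_surjective.comp (LinearMap.rTensor_surjective N hp)) _

theorem map_exact {f : N →ₗ[R] N'} {p : N' →ₗ[R] N''} (hfp : Function.Exact f p)
    (hp : Function.Surjective p) : Function.Exact (map R M f) (map R M p) := by
  refine exact_quotientAddGroupMap _ _ (lTensor_exact (f := f.toAddMonoidHom.toIntLinearMap)
    (g := p.toAddMonoidHom.toIntLinearMap) M hfp hp) ((AddSubgroup.closure_le _).2 ?_)
  rintro _ ⟨m, r, n, rfl⟩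
  obtain ⟨n, rfl⟩ := hp n
  refine ⟨_, AddSubgroup.subset_closure ⟨m, r, n, rfl⟩, ?_⟩
  rw [map_sub, ← p.map_smul]
  rfl

theorem map_ker_subtype_exact {p : N →ₗ[R] N'} (hp : Function.Surjective p) :
    Function.Exact (map R M (LinearMap.ker p).subtype) (map R M p) :=
  map_exact (N := LinearMap.ker p) p.exact_subtype_ker_map hp

theorem mapLeft_exact {f : M →ₗ[Rᵐᵒᵖ] M'} {p : M' →ₗ[Rᵐᵒᵖ] M''} (hfp : Function.Exact f p)
    (hp : Function.Surjective p) : Function.Exact (mapLeft N f) (mapLeft N p) := by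
  refine exact_quotientAddGroupMap _ _ (rTensor_exact (f := f.toAddMonoidHom.toIntLinearMap)
    (g := p.toAddMonoidHom.toIntLinearMap) N hfp hp) ((AddSubgroup.closure_le _).2 ?_)
  rintro _ ⟨m, r, n, rfl⟩
  obtain ⟨m, rfl⟩ := hp m
  refine ⟨_, AddSubgroup.subset_closure ⟨m, r, n, rfl⟩, ?_⟩
  rw [map_sub, ← p.map_smul]
  rfl

end Basic

section Free

variable {R M M' Y Q Q' : Type*} [Ring R]
  [AddCommGroup M] [Module Rᵐᵒᵖ M] [AddCommGroup M'] [Module Rᵐᵒᵖ M']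
  [AddCommGroup Q] [Module R Q] [AddCommGroup Q'] [Module R Q']

/-- The isomorphism `M ⊗_R R^(Y) ≃ M^(Y)`, `m ⊗ (r_y)_y ↦ (m r_y)_y`. -/
noncomputable def finsuppRight (R M Y : Type*) [Ring R] [AddCommGroup M] [Module Rᵐᵒᵖ M] :
    BalancedTensor R M (Y →₀ R) ≃+ (Y →₀ M) :=
  AddMonoidHom.toAddEquiv
    (lift (AddMonoidHom.mk' (fun m => Finsupp.mapRange.addMonoidHom
        (AddMonoidHom.mk' (fun r : R => MulOpposite.op r • m) fun r r' => by simp [add_smul]))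
      fun m m' => by ext; simp) fun m r n => by ext; simp [mul_smul])
    (Finsupp.liftAddHom fun y => (tmulHom R M (Y →₀ R)).flip (Finsupp.single y 1))
    (hom_ext fun m k => by
      induction k using Finsupp.induction_linear with
      | zero => simp
      | add k k' hk hk' => rw [tmul_add, map_add, map_add, hk, hk']
      | single y r => simp [smul_tmul])
    (by ext; simp)

@[simp] theorem finsuppRight_tmul (m : M) (k : Y →₀ R) (y : Y) :
    finsuppRight R M Y (tmul R m k) y = MulOpposite.op (k y) • m := rfl

theorem finsuppRight_mapLeft (g : M →ₗ[Rᵐᵒᵖ] M') (z : BalancedTensor R M (Y →₀ R)) :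
    finsuppRight R M' Y (mapLeft _ g z) = (finsuppRight R M Y z).mapRange g (map_zero g) := by
  induction z using induction_on with
  | zero => simp
  | tmul m k => ext; simp
  | add x y hx hy => ext; simp [hx, hy]

theorem mapLeft_finsupp_injective {g : M →ₗ[Rᵐᵒᵖ] M'} (hg : Function.Injective g) :
    Function.Injective (mapLeft (R := R) (Y →₀ R) g) := fun z z' h => by
  refine (finsuppRight R M Y).injective (Finsupp.mapRange_injective g (map_zero g) hg ?_)
  rw [← finsuppRight_mapLeft, h, finsuppRight_mapLeft]

/-- The coordinate map `R^(Y) ⊗_R Q → Q^(Y)`, `(r_y)_y ⊗ q ↦ (r_y q)_y`. -/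
noncomputable def coordLeft (R Y Q : Type*) [Ring R] [AddCommGroup Q] [Module R Q] :
    BalancedTensor R (Y →₀ Rᵐᵒᵖ) Q →+ (Y →₀ Q) :=
  lift (AddMonoidHom.mk' (fun k => AddMonoidHom.mk' (fun q : Q => Finsupp.mapRange.addMonoidHom
      (AddMonoidHom.mk' (fun r : Rᵐᵒᵖ => r.unop • q) fun r r' => by simp [add_smul]) k)
      fun q q' => by ext; simp)
    fun m m' => by ext; simp [add_smul]) fun m r n => by ext; simp [mul_smul]

theorem coordLeft_single_tmul (y : Y) (r : Rᵐᵒᵖ) (q : Q) :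
    coordLeft R Y Q (tmul R (Finsupp.single y r) q) = Finsupp.single y (r.unop • q) :=
  Finsupp.mapRange_single (hf := zero_smul R q)

/-- The isomorphism `R^(Y) ⊗_R Q ≃ Q^(Y)`, `(r_y)_y ⊗ q ↦ (r_y q)_y`. -/
noncomputable def finsuppLeft (R Y Q : Type*) [Ring R] [AddCommGroup Q] [Module R Q] :
    BalancedTensor R (Y →₀ Rᵐᵒᵖ) Q ≃+ (Y →₀ Q) :=
  (coordLeft R Y Q).toAddEquiv
    (Finsupp.liftAddHom fun y => tmulHom R (Y →₀ Rᵐᵒᵖ) Q (Finsupp.single y 1))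
    (hom_ext fun k q => by
      induction k using Finsupp.induction_linear with
      | zero => simp
      | add k k' hk hk' => rw [add_tmul, map_add, map_add, hk, hk']
      | single y r => simp [coordLeft_single_tmul, ← smul_tmul])
    (Finsupp.addHom_ext fun y q => by simp [coordLeft_single_tmul])

@[simp] theorem finsuppLeft_tmul (k : Y →₀ Rᵐᵒᵖ) (q : Q) (y : Y) :
    finsuppLeft R Y Q (tmul R k q) y = (k y).unop • q := rfl

theorem finsuppLeft_map (g : Q →ₗ[R] Q') (z : BalancedTensor R (Y →₀ Rᵐᵒᵖ) Q) :
    finsuppLeft R Y Q' (map R _ g z) = (finsuppLeft R Y Q z).mapRange g (map_zero g) := by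
  induction z using induction_on with
  | zero => simp
  | tmul k q => ext; simp
  | add x y hx hy => ext; simp [hx, hy]

end Free

end BalancedTensor

open BalancedTensor

section Flat

variable (R : Type u) [Ring R]

/-- Flatness of a right module: `M ⊗_R -` preserves injectivity. Unlike `flatModules`, this
applies to unbundled modules. -/
def IsFlat (M : Type*) [AddCommGroup M] [Module Rᵐᵒᵖ M] : Prop :=
  ∀ (N N' : Type u) [AddCommGroup N] [Module R N] [AddCommGroup N'] [Module R N']
    (f : N →ₗ[R] N'), Function.Injective f → Function.Injective (BalancedTensor.map R M f)

/-- Flat Mittag-Leffler right modules, encoded by the single condition that `M ⊗_R -` preserves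
jointly injective families of homomorphisms; see `flatMittagLefflerModules_iff`. -/
def IsFlatML (M : Type*) [AddCommGroup M] [Module Rᵐᵒᵖ M] : Prop :=
  ∀ (N : Type u) [AddCommGroup N] [Module R N] (I : Type u) (Q : I → Type u)
    [∀ i, AddCommGroup (Q i)] [∀ i, Module R (Q i)] (g : ∀ i, N →ₗ[R] Q i),
    (∀ n, (∀ i, g i n = 0) → n = 0) →
    ∀ z : BalancedTensor R M N, (∀ i, BalancedTensor.map R M (g i) z = 0) → z = 0

variable {R}

/-- A homomorphism of right modules is pure if it remains injective after tensoring with any left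
module. -/
def IsPureMap {A B : Type*} [AddCommGroup A] [Module Rᵐᵒᵖ A] [AddCommGroup B] [Module Rᵐᵒᵖ B]
    (f : A →ₗ[Rᵐᵒᵖ] B) : Prop :=
  ∀ (N : Type u) [AddCommGroup N] [Module R N], Function.Injective (mapLeft (R := R) N f)

variable {M A B X : Type*} [AddCommGroup M] [Module Rᵐᵒᵖ M] [AddCommGroup A] [Module Rᵐᵒᵖ A]
  [AddCommGroup B] [Module Rᵐᵒᵖ B] [AddCommGroup X] [Module Rᵐᵒᵖ X]

theorem isPureMap_id : IsPureMap (LinearMap.id : M →ₗ[Rᵐᵒᵖ] M) := fun N _ _ x y h => by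
  rwa [mapLeft_id, mapLeft_id] at h

theorem IsPureMap.comp {g : B →ₗ[Rᵐᵒᵖ] X} {f : A →ₗ[Rᵐᵒᵖ] B} (hg : IsPureMap g)
    (hf : IsPureMap f) : IsPureMap (g ∘ₗ f) := fun N _ _ x y h => by
  rw [← mapLeft_mapLeft, ← mapLeft_mapLeft] at h
  exact hf N (hg N h)

theorem IsPureMap.inclusion_trans {S T U : Submodule Rᵐᵒᵖ M} {hST : S ≤ T} {hTU : T ≤ U}
    (h : IsPureMap (Submodule.inclusion hST)) (h' : IsPureMap (Submodule.inclusion hTU)) :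
    IsPureMap (Submodule.inclusion (hST.trans hTU)) := by
  have hcomp : Submodule.inclusion (hST.trans hTU) =
      Submodule.inclusion hTU ∘ₗ Submodule.inclusion hST := rfl
  rw [hcomp]
  exact h'.comp h

theorem IsFlatML.isFlat (h : IsFlatML R M) : IsFlat R M := fun N N' _ _ _ _ f hf =>
  (injective_iff_map_eq_zero _).2 fun z hz =>
    h N PUnit (fun _ => N') (fun _ => f) (fun _ hn => (map_eq_zero_iff f hf).1 (hn ⟨⟩)) z
      fun _ => hz

theorem flatMittagLefflerModules_iff (M : ModuleCat.{u} Rᵐᵒᵖ) :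
    flatMittagLefflerModules R M ↔ IsFlatML R M := by
  constructor
  · rintro ⟨hflat, hML⟩ N _ _ I Q _ _ g hg z hz
    refine (map_eq_zero_iff _ (hflat N (∀ i, Q i) (LinearMap.pi g) ?_)).1
      ((map_eq_zero_iff _ (hML I Q)).1 ?_)
    · exact (injective_iff_map_eq_zero _).2 fun n hn => hg n fun i => congrFun hn i
    · funext i
      rw [toPi_apply, map_map]
      exact hz i
  · intro h
    refine ⟨h.isFlat, fun I Q _ _ => (injective_iff_map_eq_zero _).2 fun z hz => ?_⟩
    exact h _ I Q (fun i => LinearMap.proj i) (fun n hn => funext hn) z fun i => congrFun hz i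

theorem IsFlat.isPureMap_of_exact (hX : IsFlat R X) {i : A →ₗ[Rᵐᵒᵖ] B} {p : B →ₗ[Rᵐᵒᵖ] X}
    (hi : Function.Injective i) (hip : Function.Exact i p) (hp : Function.Surjective p) :
    IsPureMap i := by
  refine fun Q _ _ => (injective_iff_map_eq_zero _).2 fun a ha => ?_
  -- Chase the grid with rows `A → B → X` and columns `K → R^(Q) → Q`.
  let π : (Q →₀ R) →ₗ[R] Q := Finsupp.linearCombination R id
  have hπ : Function.Surjective π := Finsupp.linearCombination_id_surjective R Q
  obtain ⟨a, rfl⟩ := map_surjective (M := A) hπ a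
  rw [mapLeft_map] at ha
  obtain ⟨b, hb⟩ := (map_ker_subtype_exact hπ _).1 ha
  have hb0 : mapLeft _ p b = 0 := by
    refine (injective_iff_map_eq_zero _).1 (hX _ _ _ (LinearMap.ker π).injective_subtype) _ ?_
    rw [← mapLeft_map, hb, (mapLeft_exact hip hp).apply_apply_eq_zero]
  obtain ⟨c, rfl⟩ := (mapLeft_exact hip hp _).1 hb0
  rw [← mapLeft_map] at hb
  rw [← mapLeft_finsupp_injective hi hb, (map_ker_subtype_exact hπ).apply_apply_eq_zero]

theorem IsFlatML.extension (hA : IsFlatML R A) (hX : IsFlatML R X) {i : A →ₗ[Rᵐᵒᵖ] B}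
    {p : B →ₗ[Rᵐᵒᵖ] X} (hi : Function.Injective i) (hip : Function.Exact i p)
    (hp : Function.Surjective p) : IsFlatML R B := by
  intro N _ _ I Q _ _ g hg z hz
  have hz0 : mapLeft _ p z = 0 := hX N I Q g hg _ fun j => by
    rw [← mapLeft_map, hz, map_zero]
  obtain ⟨a, rfl⟩ := (mapLeft_exact hip hp _).1 hz0
  rw [hA N I Q g hg a fun j => ?_, map_zero]
  refine (injective_iff_map_eq_zero _).1 (hX.isFlat.isPureMap_of_exact hi hip hp (Q j)) _ ?_
  rw [mapLeft_map, hz]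

theorem IsFlatML.of_isPureMap {f : A →ₗ[Rᵐᵒᵖ] B} (hf : IsPureMap f) (hB : IsFlatML R B) :
    IsFlatML R A := fun N _ _ I Q _ _ g hg z hz =>
  (injective_iff_map_eq_zero _).1 (hf N) z (hB N I Q g hg _ fun i => by
    rw [← mapLeft_map, hz, map_zero])

theorem isPureMap_of_leftInverse {f : A →ₗ[Rᵐᵒᵖ] B} {g : B →ₗ[Rᵐᵒᵖ] A}
    (h : g ∘ₗ f = LinearMap.id) : IsPureMap f := fun N _ _ =>
  Function.LeftInverse.injective (g := mapLeft N g) fun z => by rw [mapLeft_mapLeft, h, mapLeft_id]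

theorem isPureMap_linearEquiv (e : A ≃ₗ[Rᵐᵒᵖ] B) : IsPureMap e.toLinearMap :=
  isPureMap_of_leftInverse (g := e.symm.toLinearMap) (LinearMap.ext e.symm_apply_apply)

theorem IsFlatML.of_locally_retract
    (h : ∀ (n : ℕ) (x : Fin n → M), ∃ (G : Type u) (_ : AddCommGroup G) (_ : Module Rᵐᵒᵖ G)
      (α : M →ₗ[Rᵐᵒᵖ] G) (β : G →ₗ[Rᵐᵒᵖ] M), IsFlatML R G ∧ ∀ k, β (α (x k)) = x k) :
    IsFlatML R M := by
  intro N _ _ I Q _ _ g hg z hz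
  obtain ⟨n, x, y, rfl⟩ := exists_eq_sum_tmul z
  obtain ⟨G, _, _, α, β, hG, hx⟩ := h n x
  have hα := hG N I Q g hg (mapLeft N α (∑ k, tmul R (x k) (y k))) fun i => by
    rw [← mapLeft_map, hz, map_zero]
  simpa [hx] using congrArg (mapLeft N β) hα

theorem isFlatML_finsupp (Y : Type*) : IsFlatML R (Y →₀ Rᵐᵒᵖ) := by
  intro N _ _ I Q _ _ g hg z hz
  rw [← map_eq_zero_iff _ (finsuppLeft R Y N).injective]
  ext y
  refine hg _ fun i => ?_
  simpa [hz] using (DFunLike.congr_fun (finsuppLeft_map (g i) z) y).symm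

theorem isFlatML_of_free [Module.Free Rᵐᵒᵖ M] : IsFlatML R M :=
  IsFlatML.of_isPureMap (isPureMap_linearEquiv (Module.Free.chooseBasis Rᵐᵒᵖ M).repr)
    (isFlatML_finsupp _)

section Directed

variable {ι : Type*} [Nonempty ι] {S : ι → Submodule Rᵐᵒᵖ M} {T U : Submodule Rᵐᵒᵖ M}

theorem exists_mapLeft_inclusion_eq (hS : Directed (· ≤ ·) S) (hSU : ∀ i, S i ≤ U)
    (hU : ∀ x ∈ U, ∃ j, x ∈ S j) {N : Type*} [AddCommGroup N] [Module R N]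
    (w : BalancedTensor R U N) : ∃ j w', mapLeft N (Submodule.inclusion (hSU j)) w' = w := by
  induction w using BalancedTensor.induction_on with
  | zero => exact ⟨Classical.arbitrary ι, 0, map_zero _⟩
  | tmul m n =>
    obtain ⟨j, hj⟩ := hU m m.2
    exact ⟨j, tmul R ⟨m, hj⟩ n, rfl⟩
  | add x y hx hy =>
    obtain ⟨j, x, rfl⟩ := hx
    obtain ⟨k, y, rfl⟩ := hy
    obtain ⟨l, hjl, hkl⟩ := hS j k
    refine ⟨l, mapLeft N (Submodule.inclusion hjl) x + mapLeft N (Submodule.inclusion hkl) y, ?_⟩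
    rw [map_add, mapLeft_mapLeft, mapLeft_mapLeft]
    rfl

theorem exists_mapLeft_inclusion_eq_zero (hS : Directed (· ≤ ·) S) (hSU : ∀ i, S i ≤ U)
    (hU : ∀ x ∈ U, ∃ j, x ∈ S j) (hTS : ∀ i, T ≤ S i) (hTU : T ≤ U) {N : Type*}
    [AddCommGroup N] [Module R N] {z : BalancedTensor R T N}
    (hz : mapLeft N (Submodule.inclusion hTU) z = 0) :
    ∃ j, mapLeft N (Submodule.inclusion (hTS j)) z = 0 := by
  let π : (N →₀ R) →ₗ[R] N := Finsupp.linearCombination R id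
  have hπ : Function.Surjective π := Finsupp.linearCombination_id_surjective R N
  obtain ⟨z, rfl⟩ := map_surjective hπ z
  rw [mapLeft_map] at hz
  obtain ⟨w, hw⟩ := (map_ker_subtype_exact hπ _).1 hz
  obtain ⟨j, w, rfl⟩ := exists_mapLeft_inclusion_eq hS hSU hU w
  have hzw : mapLeft _ (Submodule.inclusion (hTS j)) z =
      BalancedTensor.map R _ (LinearMap.ker π).subtype w := by
    refine mapLeft_finsupp_injective (Submodule.inclusion_injective (hSU j)) ?_
    rw [mapLeft_map, hw, mapLeft_mapLeft]
    rfl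
  exact ⟨j, by rw [mapLeft_map, hzw, (map_ker_subtype_exact hπ).apply_apply_eq_zero]⟩

theorem isPureMap_inclusion_of_directed (hS : Directed (· ≤ ·) S) (hSU : ∀ i, S i ≤ U)
    (hU : ∀ x ∈ U, ∃ j, x ∈ S j) (hTS : ∀ i, T ≤ S i) (hTU : T ≤ U)
    (hpure : ∀ j, IsPureMap (Submodule.inclusion (hTS j))) :
    IsPureMap (Submodule.inclusion hTU) := by
  refine fun N _ _ => (injective_iff_map_eq_zero _).2 fun z hz => ?_
  obtain ⟨j, hj⟩ := exists_mapLeft_inclusion_eq_zero hS hSU hU hTS hTU hz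
  exact (injective_iff_map_eq_zero _).1 (hpure j N) z hj

theorem IsFlatML.of_directed (hS : Directed (· ≤ ·) S) (hSU : ∀ i, S i ≤ U)
    (hU : ∀ x ∈ U, ∃ j, x ∈ S j) (hpure : ∀ i, IsPureMap (Submodule.inclusion (hSU i)))
    (hML : ∀ i, IsFlatML R (S i)) : IsFlatML R U := by
  intro N _ _ I Q _ _ g hg z hz
  obtain ⟨j, w, rfl⟩ := exists_mapLeft_inclusion_eq hS hSU hU z
  rw [hML j N I Q g hg w fun k => ?_, map_zero]
  refine (injective_iff_map_eq_zero _).1 (hpure j _) _ ?_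
  rw [mapLeft_map, hz]

end Directed

theorem exact_inclusion_mkQ_submoduleOf {S T : Submodule Rᵐᵒᵖ M} (h : S ≤ T) :
    Function.Exact (Submodule.inclusion h) (S.submoduleOf T).mkQ := by
  intro x
  rw [Submodule.mkQ_apply, Submodule.Quotient.mk_eq_zero]
  exact ⟨fun hx => ⟨⟨x, hx⟩, rfl⟩, fun ⟨y, hy⟩ => hy ▸ y.2⟩

theorem isPureMap_inclusion_of_isFlat {S T : Submodule Rᵐᵒᵖ M} (h : S ≤ T)
    (hflat : IsFlat R (T ⧸ S.submoduleOf T)) : IsPureMap (Submodule.inclusion h) :=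
  hflat.isPureMap_of_exact (Submodule.inclusion_injective h) (exact_inclusion_mkQ_submoduleOf h)
    (Submodule.mkQ_surjective _)

theorem IsFlatML.of_quotient_submoduleOf {S T : Submodule Rᵐᵒᵖ M} (h : S ≤ T)
    (hS : IsFlatML R S) (hT : IsFlatML R (T ⧸ S.submoduleOf T)) : IsFlatML R T :=
  hS.extension hT (Submodule.inclusion_injective h) (exact_inclusion_mkQ_submoduleOf h)
    (Submodule.mkQ_surjective _)

namespace IsContinuousFiltration

variable {M : ModuleCat.{u} Rᵐᵒᵖ} {l : Ordinal.{u}} {F : Ordinal.{u} → Submodule Rᵐᵒᵖ M}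

theorem exists_mem_Ico (hF : IsContinuousFiltration M l F) {α β : Ordinal.{u}} (hα : α ≤ l)
    (hlim : Order.IsSuccLimit α) (hβ : β < α) {x : M} (hx : x ∈ F α) :
    ∃ γ : Set.Ico β α, x ∈ F γ := by
  rw [← SetLike.mem_coe, hF.limit α hα hlim] at hx
  simp only [Set.mem_iUnion] at hx
  obtain ⟨γ, hγ, hx⟩ := hx
  exact ⟨⟨max β γ, le_max_left β γ, max_lt hβ hγ⟩,
    hF.mono _ _ (le_max_right β γ) ((max_lt hβ hγ).le.trans hα) hx⟩

theorem directed_Ico (hF : IsContinuousFiltration M l F) {α : Ordinal.{u}} (hα : α ≤ l)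
    (β : Ordinal.{u}) : Directed (· ≤ ·) fun γ : Set.Ico β α => F γ :=
  Monotone.directed_le fun _ δ h => hF.mono _ _ h (δ.2.2.le.trans hα)

theorem isPureMap_inclusion (hF : IsContinuousFiltration M l F)
    (hflat : ∀ α < l, IsFlat R (F (α + 1) ⧸ (F α).submoduleOf (F (α + 1))))
    {α β : Ordinal.{u}} (hβα : β ≤ α) (hα : α ≤ l) :
    IsPureMap (Submodule.inclusion (hF.mono β α hβα hα)) := by
  induction α using Ordinal.limitRecOn with
  | zero =>
    obtain rfl : β = 0 := by simpa using hβα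
    exact isPureMap_id
  | add_one α ih =>
    rcases hβα.lt_or_eq with hβ | rfl
    · have hαl : α < l := (Order.lt_succ α).trans_le hα
      exact (ih (Order.lt_succ_iff.1 hβ) hαl.le).inclusion_trans
        (isPureMap_inclusion_of_isFlat (hF.mono _ _ (Order.le_succ α) hα) (hflat α hαl))
    · exact isPureMap_id
  | limit α hlim ih =>
    rcases hβα.lt_or_eq with hβ | rfl
    · have : Nonempty (Set.Ico β α) := ⟨⟨β, le_rfl, hβ⟩⟩
      exact isPureMap_inclusion_of_directed (hF.directed_Ico hα β)
        (fun γ => hF.mono _ _ γ.2.2.le hα) (fun x hx => hF.exists_mem_Ico hα hlim hβ hx)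
        (fun γ => hF.mono _ _ γ.2.1 (γ.2.2.le.trans hα)) _
        fun γ => ih γ γ.2.2 γ.2.1 (γ.2.2.le.trans hα)
    · exact isPureMap_id

theorem isFlatML (hF : IsContinuousFiltration M l F)
    (hML : ∀ α < l, IsFlatML R (F (α + 1) ⧸ (F α).submoduleOf (F (α + 1))))
    {α : Ordinal.{u}} (hα : α ≤ l) : IsFlatML R (F α) := by
  induction α using Ordinal.limitRecOn with
  | zero =>
    rw [hF.zero]
    exact isFlatML_of_free
  | add_one α ih =>
    have hαl : α < l := (Order.lt_succ α).trans_le hα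
    exact (ih hαl.le).of_quotient_submoduleOf (hF.mono _ _ (Order.le_succ α) hα) (hML α hαl)
  | limit α hlim ih =>
    have : Nonempty (Set.Ico 0 α) := ⟨⟨0, le_rfl, hlim.bot_lt⟩⟩
    exact IsFlatML.of_directed (hF.directed_Ico hα 0) (fun γ => hF.mono _ _ γ.2.2.le hα)
      (fun x hx => hF.exists_mem_Ico hα hlim hlim.bot_lt hx)
      (fun γ => hF.isPureMap_inclusion (fun α h => (hML α h).isFlat) γ.2.2.le hα)
      fun γ => ih γ γ.2.2 (γ.2.2.le.trans hα)

end IsContinuousFiltration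

theorem closedUnderTransfiniteExtensions_flatMittagLefflerModules :
    ClosedUnderTransfiniteExtensions (flatMittagLefflerModules R) := by
  rintro M ⟨l, F, hF, hA⟩
  rw [flatMittagLefflerModules_iff]
  have hML : IsFlatML R (F l) := by
    refine hF.isFlatML (fun α hα => ?_) le_rfl
    obtain ⟨X, hX, ⟨e⟩⟩ := hA α hα
    exact IsFlatML.of_isPureMap (isPureMap_linearEquiv e) ((flatMittagLefflerModules_iff X).1 hX)
  rw [hF.last] at hML
  exact IsFlatML.of_isPureMap (isPureMap_linearEquiv Submodule.topEquiv.symm) hML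

end Flat

section Ext

variable {S : Type u} [Ring S]
variable {A P X C : Type u} [AddCommGroup A] [Module S A] [AddCommGroup P] [Module S P]
  [AddCommGroup X] [Module S X] [AddCommGroup C] [Module S C]

theorem shortExact_ofHom {i : A →ₗ[S] P} {p : P →ₗ[S] X} (hi : Function.Injective i)
    (hip : Function.Exact i p) (hp : Function.Surjective p) :
    (ShortComplex.mk (ModuleCat.ofHom i) (ModuleCat.ofHom p)
      (by rw [← ModuleCat.ofHom_comp, hip.linearMap_comp_eq_zero]; rfl)).ShortExact where
  exact := (ShortComplex.ShortExact.moduleCat_exact_iff_function_exact _).2 hip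
  mono_f := (ModuleCat.mono_iff_injective _).2 hi
  epi_g := (ModuleCat.epi_iff_surjective _).2 hp

theorem exists_extension_of_subsingleton_ext {i : A →ₗ[S] P} {p : P →ₗ[S] X}
    (hi : Function.Injective i) (hip : Function.Exact i p) (hp : Function.Surjective p)
    (h : Subsingleton (Abelian.Ext (ModuleCat.of S X) (ModuleCat.of S C) 1)) (g : A →ₗ[S] C) :
    ∃ g' : P →ₗ[S] C, g' ∘ₗ i = g := by
  obtain ⟨x, hx⟩ := Abelian.Ext.contravariant_sequence_exact₁ (shortExact_ofHom hi hip hp)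
    (ModuleCat.of S C) (Abelian.Ext.mk₀ (ModuleCat.ofHom g)) (n₁ := 1) rfl
    (Subsingleton.elim _ _)
  obtain ⟨f, rfl⟩ := (Abelian.Ext.mk₀_bijective _ _).2 x
  rw [Abelian.Ext.mk₀_comp_mk₀] at hx
  have hfg := (Abelian.Ext.mk₀_bijective _ _).1 hx
  exact ⟨f.hom, by simpa using congrArg ModuleCat.Hom.hom hfg⟩

theorem exists_lift_of_subsingleton_ext {i : A →ₗ[S] P} {p : P →ₗ[S] C}
    (hi : Function.Injective i) (hip : Function.Exact i p) (hp : Function.Surjective p)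
    (h : Subsingleton (Abelian.Ext (ModuleCat.of S X) (ModuleCat.of S A) 1)) (g : X →ₗ[S] C) :
    ∃ g' : X →ₗ[S] P, p ∘ₗ g' = g := by
  obtain ⟨x, hx⟩ := Abelian.Ext.covariant_sequence_exact₃ (ModuleCat.of S X)
    (shortExact_ofHom hi hip hp) (Abelian.Ext.mk₀ (ModuleCat.ofHom g)) (n₁ := 1) rfl
    (Subsingleton.elim _ _)
  obtain ⟨f, rfl⟩ := (Abelian.Ext.mk₀_bijective _ _).2 x
  rw [Abelian.Ext.mk₀_comp_mk₀] at hx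
  have hfg := (Abelian.Ext.mk₀_bijective _ _).1 hx
  exact ⟨f.hom, by simpa using congrArg ModuleCat.Hom.hom hfg⟩

theorem subsingleton_ext_of_exists_extension [Module.Projective S P] {i : A →ₗ[S] P}
    {p : P →ₗ[S] X} (hi : Function.Injective i) (hip : Function.Exact i p)
    (hp : Function.Surjective p) (h : ∀ g : A →ₗ[S] C, ∃ g' : P →ₗ[S] C, g' ∘ₗ i = g) :
    Subsingleton (Abelian.Ext (ModuleCat.of S X) (ModuleCat.of S C) 1) := by
  have hS := shortExact_ofHom hi hip hp
  have : Projective (ModuleCat.of S P) := (IsProjective.iff_projective P).1 inferInstance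
  refine subsingleton_of_forall_eq 0 fun x => ?_
  obtain ⟨y, rfl⟩ := Abelian.Ext.contravariant_sequence_exact₃ hS (ModuleCat.of S C) x
    (Abelian.Ext.eq_zero_of_projective _) (n₀ := 0) rfl
  obtain ⟨f, rfl⟩ := (Abelian.Ext.mk₀_bijective _ _).2 y
  obtain ⟨g, hg⟩ := h f.hom
  have hf : f = ModuleCat.ofHom i ≫ ModuleCat.ofHom g := by
    ext a
    exact (LinearMap.congr_fun hg a).symm
  rw [hf, ← Abelian.Ext.mk₀_comp_mk₀, hS.extClass_comp_assoc]

end Ext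

section Telescope

variable {S : Type*} [Ring S] {E : Type*} [AddCommGroup E] [Module S E]

/-- The map `e_n x ↦ e_n x - e_{n+1} (f_n x)` of `E^(ℕ)`; its cokernel is the direct limit of
`E → E → ⋯` along the maps `f_n`. -/
noncomputable def telescope (f : ℕ → E →ₗ[S] E) : (ℕ →₀ E) →ₗ[S] (ℕ →₀ E) :=
  Finsupp.lsum ℕ fun n => Finsupp.lsingle n - Finsupp.lsingle (n + 1) ∘ₗ f n

@[simp] theorem telescope_single (f : ℕ → E →ₗ[S] E) (n : ℕ) (x : E) :
    telescope f (Finsupp.single n x) = Finsupp.single n x - Finsupp.single (n + 1) (f n x) := by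
  simp [telescope]

theorem telescope_apply_zero (f : ℕ → E →ₗ[S] E) (z : ℕ →₀ E) : telescope f z 0 = z 0 := by
  induction z using Finsupp.induction_linear with
  | zero => simp
  | add x y hx hy => simp [hx, hy]
  | single n x => simp

theorem telescope_apply_succ (f : ℕ → E →ₗ[S] E) (z : ℕ →₀ E) (n : ℕ) :
    telescope f z (n + 1) = z (n + 1) - f n (z n) := by
  induction z using Finsupp.induction_linear with
  | zero => simp
  | add x y hx hy => simp only [map_add, Finsupp.add_apply, hx, hy, add_sub_add_comm]
  | single m x =>
    rw [telescope_single, Finsupp.sub_apply]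
    obtain rfl | h := eq_or_ne m n
    · simp
    · simp [Finsupp.single_apply, h]

theorem telescope_injective (f : ℕ → E →ₗ[S] E) : Function.Injective (telescope f) := by
  refine (injective_iff_map_eq_zero _).2 fun z hz => Finsupp.ext fun n => ?_
  induction n with
  | zero => rw [← telescope_apply_zero f, hz]
  | succ n ih =>
    have hn := telescope_apply_succ f z n
    rw [hz, ih] at hn
    simpa using hn.symm

end Telescope

namespace TreeModule

open Filter

section Nodes

variable {κ : Type*}

/-- Finite sequences in `κ`, the nodes of the tree whose branches are the sequences `ℕ → κ`. -/
abbrev Node (κ : Type*) : Type _ := Σ n : ℕ, Fin n → κ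

/-- The initial segment of length `n` of a branch. -/
def node (η : ℕ → κ) (n : ℕ) : Node κ := ⟨n, fun i => η i⟩

theorem node_eq_iff {η τ : ℕ → κ} {n : ℕ} : node η n = node τ n ↔ ∀ i < n, η i = τ i := by
  simp only [node, Sigma.mk.injEq, heq_eq_eq, true_and, funext_iff]
  exact ⟨fun h i hi => h ⟨i, hi⟩, fun h i => h i i.2⟩

theorem node_eq_of_le {η τ : ℕ → κ} {m n : ℕ} (h : m ≤ n) (hn : node η n = node τ n) :
    node η m = node τ m :=
  node_eq_iff.2 fun i hi => node_eq_iff.1 hn i (hi.trans_le h)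

theorem eventually_node_ne {η τ : ℕ → κ} (h : η ≠ τ) : ∀ᶠ n in atTop, node η n ≠ node τ n := by
  obtain ⟨i, hi⟩ := Function.ne_iff.1 h
  filter_upwards [eventually_gt_atTop i] with n hn heq using hi (node_eq_iff.1 heq i hn)

theorem eventually_injOn_node (T : Finset (ℕ → κ)) :
    ∀ᶠ n in atTop, Set.InjOn (fun η : ℕ → κ => node η n) T := by
  have hpair (η τ : ℕ → κ) : ∀ᶠ n in atTop, node η n = node τ n → η = τ := by
    by_cases h : η = τ
    · exact Eventually.of_forall fun _ _ => h
    · exact (eventually_node_ne h).mono fun _ hne heq => absurd heq hne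
  filter_upwards [(eventually_all_finset T).2 fun η _ =>
    (eventually_all_finset T).2 fun τ _ => hpair η τ] with n hn η hη τ hτ using hn η hη τ hτ

end Nodes

section Definitions

variable {S : Type*} [Ring S] {E : Type*} [AddCommGroup E] [Module S E] {κ : Type*}

/-- The generators of the tree module: one copy of `E` for each node, and one copy of `E` for
each branch and each natural number. -/
abbrev Gen (E κ : Type*) [AddCommGroup E] : Type _ := (Node κ →₀ E) × ((ℕ → κ) →₀ ℕ →₀ E)

variable (S) in
/-- The copy of `E` at a node. -/
noncomputable def atNode (s : Node κ) : E →ₗ[S] Gen E κ :=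
  LinearMap.inl S _ _ ∘ₗ Finsupp.lsingle s

variable (S) in
/-- The `n`-th copy of `E` on a branch. -/
noncomputable def atBranch (η : ℕ → κ) (n : ℕ) : E →ₗ[S] Gen E κ :=
  LinearMap.inr S _ _ ∘ₗ Finsupp.lsingle η ∘ₗ Finsupp.lsingle n

/-- The relations `atBranch η n x - atBranch η (n + 1) (f n x) = atNode (node η n) x` of the tree
module, written as a homomorphism from the free object on the branches. -/
noncomputable def relation (κ : Type*) (f : ℕ → E →ₗ[S] E) :
    ((ℕ → κ) →₀ ℕ →₀ E) →ₗ[S] Gen E κ :=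
  (-Finsupp.lsum ℕ fun η => Finsupp.lmapDomain E S (node η)).prod
    (Finsupp.mapRange.linearMap (telescope f))

/-- The tree module of the sequence `f`: copies of the telescope of `f`, one for each branch of
the tree `Node κ`, glued along the nodes. -/
abbrev _root_.TreeModule (κ : Type*) (f : ℕ → E →ₗ[S] E) : Type _ :=
  Gen E κ ⧸ LinearMap.range (relation κ f)

variable (f : ℕ → E →ₗ[S] E)

theorem relation_single (η : ℕ → κ) (n : ℕ) (x : E) :
    relation κ f (Finsupp.single η (Finsupp.single n x)) =
      atBranch S η n x - atBranch S η (n + 1) (f n x) - atNode S (node η n) x := by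
  simp [relation, atBranch, atNode, Finsupp.mapDomain_single]

theorem relation_injective : Function.Injective (relation κ f) := fun _ _ h =>
  Finsupp.mapRange_injective _ (map_zero _) (telescope_injective f) (congrArg Prod.snd h)

section Maps

variable {P : Type*} [AddCommGroup P] [Module S P]

theorem map_eq_map_of_support {φ ψ : Gen E κ →ₗ[S] P} (p : Gen E κ)
    (hnode : ∀ s ∈ p.1.support, φ ∘ₗ atNode S s = ψ ∘ₗ atNode S s)
    (hbranch : ∀ η ∈ p.2.support, ∀ n, φ ∘ₗ atBranch S η n = ψ ∘ₗ atBranch S η n) :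
    φ p = ψ p := by
  have hp : p = p.1.sum (fun s x => atNode S s x) +
      p.2.sum fun η z => LinearMap.inr S _ _ (Finsupp.single η z) := by
    simp only [atNode, LinearMap.comp_apply, Finsupp.lsingle_apply, ← map_finsuppSum,
      Finsupp.sum_single]
    simp
  have hb (η) (hη : η ∈ p.2.support) : φ ∘ₗ LinearMap.inr S _ _ ∘ₗ Finsupp.lsingle η =
      ψ ∘ₗ LinearMap.inr S _ _ ∘ₗ Finsupp.lsingle η :=
    Finsupp.lhom_ext' fun n => hbranch η hη n
  rw [hp, map_add, map_add, map_finsuppSum, map_finsuppSum, map_finsuppSum, map_finsuppSum]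
  exact congrArg₂ _ (Finsupp.sum_congr fun s hs => LinearMap.congr_fun (hnode s hs) _)
    (Finsupp.sum_congr fun η hη => LinearMap.congr_fun (hb η hη) _)

theorem comp_relation_eq_zero_iff {φ : Gen E κ →ₗ[S] P} : φ ∘ₗ relation κ f = 0 ↔
    ∀ η n, φ ∘ₗ atBranch S η n =
      (φ ∘ₗ atBranch S η (n + 1)) ∘ₗ f n + φ ∘ₗ atNode S (node η n) := by
  have hsingle (η n x) : (φ ∘ₗ relation κ f) (Finsupp.single η (Finsupp.single n x)) = 0 ↔
      (φ ∘ₗ atBranch S η n) x =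
        ((φ ∘ₗ atBranch S η (n + 1)) ∘ₗ f n + φ ∘ₗ atNode S (node η n)) x := by
    simp only [LinearMap.comp_apply, relation_single, map_sub, LinearMap.add_apply, sub_sub,
      sub_eq_zero, map_add]
  refine ⟨fun h η n => LinearMap.ext fun x => (hsingle η n x).1 (by rw [h]; rfl), fun h => ?_⟩
  exact Finsupp.lhom_ext' fun η => Finsupp.lhom_ext' fun n => LinearMap.ext fun x =>
    (hsingle η n x).2 (by rw [h])

theorem comp_atBranch_eq_of_eventuallyEq {φ ψ : Gen E κ →ₗ[S] P} (hφ : φ ∘ₗ relation κ f = 0)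
    (hψ : ψ ∘ₗ relation κ f = 0) {η : ℕ → κ}
    (hnode : ∀ n, φ ∘ₗ atNode S (node η n) = ψ ∘ₗ atNode S (node η n))
    (hbranch : ∀ᶠ n in atTop, φ ∘ₗ atBranch S η n = ψ ∘ₗ atBranch S η n) (n : ℕ) :
    φ ∘ₗ atBranch S η n = ψ ∘ₗ atBranch S η n := by
  obtain ⟨k, hnk, hk⟩ := ((eventually_ge_atTop n).and hbranch).exists
  induction hnk using Nat.decreasingInduction with
  | self => exact hk
  | of_succ m _ ih =>
    rw [(comp_relation_eq_zero_iff f).1 hφ, (comp_relation_eq_zero_iff f).1 hψ, ih, hnode]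

theorem exists_descending_of_ge (δ : ℕ → E →ₗ[S] P) {k : ℕ} {b : ℕ → E →ₗ[S] P}
    (hb : ∀ n ≥ k, b n = b (n + 1) ∘ₗ f n + δ n) :
    ∃ a : ℕ → E →ₗ[S] P, (∀ n, a n = a (n + 1) ∘ₗ f n + δ n) ∧ ∀ n ≥ k, a n = b n := by
  induction k generalizing b with
  | zero => exact ⟨b, fun n => hb n n.zero_le, fun _ _ => rfl⟩
  | succ k ih =>
    obtain ⟨a, ha, hab⟩ := ih (b := Function.update b k (b (k + 1) ∘ₗ f k + δ k)) fun n hn => by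
      obtain rfl | hn := hn.eq_or_lt
      · simp
      · rw [Function.update_of_ne (by lia), Function.update_of_ne (by lia)]
        exact hb n hn
    exact ⟨a, ha, fun n hn => by rw [hab n (by lia), Function.update_of_ne (by lia)]⟩

theorem exists_comp_relation_eq_zero (d : Node κ → E →ₗ[S] P) (b : (ℕ → κ) → ℕ → E →ₗ[S] P)
    (hb : ∀ η, ∀ᶠ n in atTop, b η n = b η (n + 1) ∘ₗ f n + d (node η n)) :
    ∃ φ : Gen E κ →ₗ[S] P, φ ∘ₗ relation κ f = 0 ∧ (∀ s, φ ∘ₗ atNode S s = d s) ∧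
      ∀ η, ∀ᶠ n in atTop, φ ∘ₗ atBranch S η n = b η n := by
  choose k hk using fun η => eventually_atTop.1 (hb η)
  choose a ha hab using fun η => exists_descending_of_ge f (fun n => d (node η n)) (hk η)
  let φ : Gen E κ →ₗ[S] P :=
    (Finsupp.lsum ℕ d).coprod (Finsupp.lsum ℕ fun η => Finsupp.lsum ℕ (a η))
  have hφnode (s) : φ ∘ₗ atNode S s = d s := by ext; simp [φ, atNode]
  have hφbranch (η n) : φ ∘ₗ atBranch S η n = a η n :=
    LinearMap.ext fun x => by simp [φ, atBranch, -Finsupp.coe_lsum, Finsupp.lsum_single]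
  refine ⟨φ, (comp_relation_eq_zero_iff f).2 fun η n => ?_, hφnode, fun η => ?_⟩
  · rw [hφbranch, hφbranch, hφnode, ha]
  · filter_upwards [eventually_ge_atTop (k η)] with n hn
    rw [hφbranch, hab η n hn]

end Maps

section Approximation

open Classical in
/-- The values at the nodes of an endomorphism of `Gen E κ` which kills the relations and induces
the identity on the branches in `T` and on the nodes below level `N`. -/
noncomputable def approxNode (T : Finset (ℕ → κ)) (N : ℕ) (s : Node κ) : E →ₗ[S] Gen E κ :=
  if s.1 < N then atNode S s
  else ∑ η ∈ T with node η s.1 = s, (atBranch S η s.1 - atBranch S η (s.1 + 1) ∘ₗ f s.1)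

variable {T : Finset (ℕ → κ)} {N : ℕ}

theorem approxNode_of_lt {s : Node κ} (hs : s.1 < N) : approxNode f T N s = atNode S s :=
  if_pos hs

theorem approxNode_node_of_mem (hN : Set.InjOn (fun η : ℕ → κ => node η N) T) {η : ℕ → κ}
    (hη : η ∈ T) {n : ℕ} (hn : N ≤ n) :
    approxNode f T N (node η n) = atBranch S η n - atBranch S η (n + 1) ∘ₗ f n := by
  classical
  have hfilter : {τ ∈ T | node τ n = node η n} = ({η} : Finset (ℕ → κ)) := by
    ext τ
    simp only [Finset.mem_filter, Finset.mem_singleton]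
    exact ⟨fun h => hN h.1 hη (node_eq_of_le hn h.2), by rintro rfl; exact ⟨hη, rfl⟩⟩
  rw [approxNode, if_neg (by simpa [node] using hn)]
  change ∑ τ ∈ T with node τ n = node η n, _ = _
  rw [hfilter, Finset.sum_singleton]
  rfl

theorem eventually_approxNode_node_eq_zero {η : ℕ → κ} (hη : η ∉ T) :
    ∀ᶠ n in atTop, approxNode f T N (node η n) = 0 := by
  classical
  have hne : ∀ᶠ n in atTop, ∀ τ ∈ T, node τ n ≠ node η n :=
    (eventually_all_finset T).2 fun τ hτ => eventually_node_ne (ne_of_mem_of_not_mem hτ hη)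
  filter_upwards [eventually_ge_atTop N, hne] with n hn hne
  rw [approxNode, if_neg (by simpa [node] using hn)]
  exact Finset.sum_eq_zero fun τ hτ => absurd (Finset.mem_filter.1 hτ).2
    (hne τ (Finset.mem_filter.1 hτ).1)

theorem exists_approx (hN : Set.InjOn (fun η : ℕ → κ => node η N) T) :
    ∃ α : Gen E κ →ₗ[S] Gen E κ, α ∘ₗ relation κ f = 0 ∧
      (∀ s : Node κ, s.1 < N → α ∘ₗ atNode S s = atNode S s) ∧
      ∀ η ∈ T, ∀ n, (LinearMap.range (relation κ f)).mkQ ∘ₗ α ∘ₗ atBranch S η n =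
        (LinearMap.range (relation κ f)).mkQ ∘ₗ atBranch S η n := by
  classical
  set π := (LinearMap.range (relation κ f)).mkQ
  have hπ : π ∘ₗ relation κ f = 0 := LinearMap.range_mkQ_comp _
  obtain ⟨α, hα, hαnode, hαbranch⟩ := exists_comp_relation_eq_zero f (approxNode f T N)
    (fun η n => if η ∈ T then atBranch S η n else 0) fun η => by
      by_cases hη : η ∈ T
      · filter_upwards [eventually_ge_atTop N] with n hn
        simp only [hη, if_true, approxNode_node_of_mem f hN hη hn]
        abel
      · filter_upwards [eventually_approxNode_node_eq_zero f (N := N) hη] with n hn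
        simp [hη, hn]
  refine ⟨α, hα, fun s hs => by rw [hαnode, approxNode_of_lt f hs], fun η hη n => ?_⟩
  have hαπ : (π ∘ₗ α) ∘ₗ relation κ f = 0 := by
    rw [LinearMap.comp_assoc, hα, LinearMap.comp_zero]
  refine comp_atBranch_eq_of_eventuallyEq f hαπ hπ (fun m => ?_) ?_ n
  · rw [LinearMap.comp_assoc, hαnode]
    obtain hm | hm := lt_or_ge m N
    · rw [approxNode_of_lt f hm]
    · rw [approxNode_node_of_mem f hN hη hm, LinearMap.comp_sub,
        (comp_relation_eq_zero_iff f).1 hπ, ← LinearMap.comp_assoc, add_sub_cancel_left]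
  · filter_upwards [hαbranch η] with m hm
    rw [LinearMap.comp_assoc, hm, if_pos hη]

end Approximation

end Definitions

theorem isFlatML {R : Type u} [Ring R] {E : Type u} [AddCommGroup E] [Module Rᵐᵒᵖ E]
    [Module.Free Rᵐᵒᵖ E] (κ : Type u) (f : ℕ → E →ₗ[Rᵐᵒᵖ] E) : IsFlatML R (TreeModule κ f) := by
  classical
  refine IsFlatML.of_locally_retract fun m x => ?_
  choose p hp using fun k => Submodule.mkQ_surjective (LinearMap.range (relation κ f)) (x k)
  let T : Finset (ℕ → κ) := Finset.univ.biUnion fun k => (p k).2.support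
  have hlevel : ∀ᶠ N in atTop, ∀ k, ∀ s ∈ (p k).1.support, s.1 < N :=
    eventually_all.2 fun k => (eventually_all_finset _).2 fun s _ => eventually_gt_atTop s.1
  obtain ⟨N, hNT, hNs⟩ := ((eventually_injOn_node T).and hlevel).exists
  obtain ⟨α, hα, hαnode, hαbranch⟩ := exists_approx f hNT
  refine ⟨Gen E κ, _, _, Submodule.liftQ _ α (LinearMap.range_le_ker_iff.2 hα),
    Submodule.mkQ _, isFlatML_of_free, fun k => ?_⟩
  rw [← hp k]
  exact map_eq_map_of_support (φ := Submodule.mkQ _ ∘ₗ α) (ψ := Submodule.mkQ _) (p k)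
    (fun s hs => by rw [LinearMap.comp_assoc, hαnode s (hNs k s hs)])
    fun η hη n => hαbranch η (Finset.mem_biUnion.2 ⟨k, Finset.mem_univ _, hη⟩) n

section Counting

variable (H : Type u)

/-- Iterated power sets of `H ⊕ ℕ`. -/
def Tower : ℕ → Type u
  | 0 => H ⊕ ULift.{u} ℕ
  | n + 1 => Set (Tower n)

/-- The union of the iterated power sets of `H ⊕ ℕ`, of strong limit cardinality of countable
cofinality. -/
abbrev Limit : Type u := Σ n, Tower H n

theorem mk_set_limit_le : Cardinal.mk (Set (Limit H)) ≤ Cardinal.mk (ℕ → Limit H) := by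
  refine Cardinal.mk_le_of_injective
    (f := fun s n => (⟨n + 1, show Set (Tower H n) from {x | (⟨n, x⟩ : Limit H) ∈ s}⟩ : Limit H))
    fun s t h => ?_
  ext ⟨n, x⟩
  have hn := sigma_mk_injective (congrFun h n)
  exact Set.ext_iff.1 hn x

theorem mk_sum_le_mk_limit : Cardinal.mk (H ⊕ ULift.{u} ℕ) ≤ Cardinal.mk (Limit H) :=
  Cardinal.mk_le_of_injective (sigma_mk_injective (β := Tower H) (i := 0))

theorem mk_node_limit_fun_le :
    Cardinal.mk (Node (Limit H) → H) ≤ Cardinal.mk (Set (Limit H)) := by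
  have hκ := mk_sum_le_mk_limit H
  rw [Cardinal.mk_sum, Cardinal.lift_id, Cardinal.lift_id] at hκ
  have hinf : Cardinal.aleph0 ≤ Cardinal.mk (Limit H) := by
    simpa using (self_le_add_left _ _).trans hκ
  have : Infinite (Limit H) := Cardinal.infinite_iff.2 hinf
  have hnode : Cardinal.mk (Node (Limit H)) = Cardinal.mk (Limit H) := by
    rw [← Cardinal.mk_congr List.equivSigmaTuple, Cardinal.mk_list_eq_mk]
  have hH : Cardinal.mk H ≤ Cardinal.mk (Limit H) := (self_le_add_right _ _).trans hκ
  rw [← Cardinal.power_def, hnode, Cardinal.mk_set]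
  calc Cardinal.mk H ^ Cardinal.mk (Limit H)
      ≤ (2 ^ Cardinal.mk (Limit H)) ^ Cardinal.mk (Limit H) :=
        Cardinal.power_le_power_right (hH.trans (Cardinal.cantor _).le)
    _ = 2 ^ Cardinal.mk (Limit H) := by rw [← Cardinal.power_mul, Cardinal.mul_eq_self hinf]

theorem not_injective_node_limit (φ : Set (ℕ → Limit H) → Node (Limit H) → H) :
    ¬ Function.Injective φ := fun hφ => by
  have h := (Cardinal.mk_le_of_injective hφ).trans
    ((mk_node_limit_fun_le H).trans (mk_set_limit_le H))
  rw [Cardinal.mk_set] at h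
  exact (Cardinal.cantor _).not_ge h

end Counting

end TreeModule

section Telescope

open TreeModule

variable {R : Type u} [Ring R] {E C : Type u} [AddCommGroup E] [Module Rᵐᵒᵖ E]
  [AddCommGroup C] [Module Rᵐᵒᵖ C]

theorem exists_comp_telescope_of_comp_atNode_eq {κ : Type*} {f : ℕ → E →ₗ[Rᵐᵒᵖ] E}
    {g : (ℕ →₀ E) →ₗ[Rᵐᵒᵖ] C} {η : ℕ → κ} {φ ψ : Gen E κ →ₗ[Rᵐᵒᵖ] C}
    (hφ : φ ∘ₗ relation κ f ∘ₗ Finsupp.lsingle η = g)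
    (hψ : ψ ∘ₗ relation κ f ∘ₗ Finsupp.lsingle η = 0)
    (hnode : ∀ s, φ ∘ₗ atNode Rᵐᵒᵖ s = ψ ∘ₗ atNode Rᵐᵒᵖ s) :
    ∃ g' : (ℕ →₀ E) →ₗ[Rᵐᵒᵖ] C, g' ∘ₗ telescope f = g := by
  refine ⟨Finsupp.lsum ℕ fun n => (φ - ψ) ∘ₗ atBranch Rᵐᵒᵖ η n, ?_⟩
  refine Finsupp.lhom_ext' fun n => LinearMap.ext fun x => ?_
  have hφx := LinearMap.congr_fun hφ (Finsupp.single n x)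
  have hψx := LinearMap.congr_fun hψ (Finsupp.single n x)
  have hx := LinearMap.congr_fun (hnode (node η n)) x
  simp only [LinearMap.comp_apply, Finsupp.lsingle_apply, relation_single, map_sub,
    LinearMap.zero_apply] at hφx hψx hx
  simp only [LinearMap.comp_apply, Finsupp.lsingle_apply, telescope_single, map_sub,
    Finsupp.lsum_single, LinearMap.sub_apply]
  rw [← sub_zero (g _), ← hψx, ← hφx, hx]
  abel

/-- Solving `g' ∘ telescope f = g` fails only if the restrictions to the nodes of solutions for
the branches in `s` separate all sets `s` of branches, and there are too many such sets. -/
theorem exists_extension_telescope [Module.Free Rᵐᵒᵖ E]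
    (hC : rightExtOrthogonal (flatMittagLefflerModules R) (ModuleCat.of Rᵐᵒᵖ C))
    (f : ℕ → E →ₗ[Rᵐᵒᵖ] E) (g : (ℕ →₀ E) →ₗ[Rᵐᵒᵖ] C) :
    ∃ g' : (ℕ →₀ E) →ₗ[Rᵐᵒᵖ] C, g' ∘ₗ telescope f = g := by
  classical
  by_contra hg
  let κ := Limit (E →ₗ[Rᵐᵒᵖ] C)
  have hext (s : Set (ℕ → κ)) : ∃ ψ : Gen E κ →ₗ[Rᵐᵒᵖ] C,
      ψ ∘ₗ relation κ f = Finsupp.lsum ℕ fun η => if η ∈ s then g else 0 :=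
    exists_extension_of_subsingleton_ext (relation_injective f)
      (LinearMap.exact_map_mkQ_range _) (Submodule.mkQ_surjective _)
      (hC _ ((flatMittagLefflerModules_iff _).2 (isFlatML κ f))) _
  choose ψ hψ using hext
  have hψη (s : Set (ℕ → κ)) (η : ℕ → κ) :
      ψ s ∘ₗ relation κ f ∘ₗ Finsupp.lsingle η = if η ∈ s then g else 0 := by
    rw [← LinearMap.comp_assoc, hψ]
    ext
    simp
  have hsubset {s t : Set (ℕ → κ)}
      (hst : ∀ n, ψ s ∘ₗ atNode Rᵐᵒᵖ n = ψ t ∘ₗ atNode Rᵐᵒᵖ n) : s ⊆ t := fun η hs => by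
    by_contra ht
    exact hg (exists_comp_telescope_of_comp_atNode_eq ((hψη s η).trans (if_pos hs))
      ((hψη t η).trans (if_neg ht)) hst)
  refine not_injective_node_limit _ (fun s n => ψ s ∘ₗ atNode Rᵐᵒᵖ n) fun s t hst => ?_
  exact (hsubset (congrFun hst)).antisymm (hsubset fun n => (congrFun hst n).symm)

end Telescope

section Rings

/-- Every descending chain of principal left ideals `R a₀ ⊇ R a₁ a₀ ⊇ ⋯` stabilizes. -/
def PrincipalLeftChainsStabilize (R : Type*) [Ring R] : Prop :=
  ∀ a : ℕ → R, ∃ n, ∀ m ≥ n, ∃ r, descendingProd a m = r * descendingProd a (m + 1)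

variable {R A : Type*} [Ring R] [Ring A]

theorem map_descendingProd (φ : R →+* A) (a : ℕ → R) (n : ℕ) :
    φ (descendingProd a n) = descendingProd (fun k => φ (a k)) n := by
  induction n with
  | zero => exact map_one φ
  | succ n ih => rw [descendingProd, map_mul, ih, descendingProd]

theorem PrincipalLeftChainsStabilize.of_surjective (h : PrincipalLeftChainsStabilize R)
    {φ : R →+* A} (hφ : Function.Surjective φ) : PrincipalLeftChainsStabilize A := by
  intro a
  choose b hb using fun n => hφ (a n)
  obtain rfl : (fun n => φ (b n)) = a := funext hb
  obtain ⟨n, hn⟩ := h b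
  refine ⟨n, fun m hm => ?_⟩
  obtain ⟨r, hr⟩ := hn m hm
  exact ⟨φ r, by rw [← map_descendingProd, ← map_descendingProd, hr, map_mul]⟩

theorem PrincipalLeftChainsStabilize.wellFounded (h : PrincipalLeftChainsStabilize A) :
    WellFounded fun x y : A => Ideal.span {x} < Ideal.span {y} := by
  refine wellFounded_iff_isEmpty_descending_chain.2 ⟨fun ⟨x, hx⟩ => ?_⟩
  choose a ha using fun n => Ideal.mem_span_singleton'.1 (Ideal.span_singleton_le_iff_mem _ |>.1
    (hx n).le)
  have hprod (n : ℕ) : descendingProd (fun n => Nat.casesOn n (x 0) a) (n + 1) = x n := by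
    induction n with
    | zero => simp [descendingProd]
    | succ n ih => rw [descendingProd, ih]; exact ha n
  obtain ⟨n, hn⟩ := h fun n => Nat.casesOn n (x 0) a
  obtain ⟨r, hr⟩ := hn (n + 1) n.le_succ
  rw [hprod, hprod] at hr
  exact (hx n).not_ge ((Ideal.span_singleton_le_iff_mem _).2
    (Ideal.mem_span_singleton'.2 ⟨r, hr.symm⟩))

theorem PrincipalLeftChainsStabilize.exists_isAtom_le (h : PrincipalLeftChainsStabilize A)
    {I : Ideal A} (hI : I ≠ ⊥) : ∃ K ≤ I, IsAtom K := by
  obtain ⟨x₀, hx₀⟩ := Submodule.exists_mem_ne_zero_of_ne_bot hI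
  obtain ⟨x, ⟨hxI, hx⟩, hmin⟩ := h.wellFounded.has_min {x | x ∈ I ∧ x ≠ 0} ⟨x₀, hx₀⟩
  have hspan : Ideal.span {x} ≤ I := (Ideal.span_singleton_le_iff_mem _).2 hxI
  refine ⟨Ideal.span {x}, hspan, fun h0 => hx (Ideal.span_singleton_eq_bot.1 h0), fun K hK => ?_⟩
  by_contra hK0
  obtain ⟨y, hy, hy0⟩ := Submodule.exists_mem_ne_zero_of_ne_bot hK0
  exact hmin y ⟨hspan (hK.le hy), hy0⟩
    (((Ideal.span_singleton_le_iff_mem _).2 hy).trans_lt hK)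

theorem exists_isCompl_of_isAtom (hJ : Ring.jacobson A = ⊥) {I : Ideal A} (hI : IsAtom I) :
    ∃ m, IsCompl I m := by
  obtain ⟨m, hm, hIm⟩ : ∃ m : Ideal A, IsCoatom m ∧ ¬ I ≤ m := by
    by_contra! hall
    have hle : I ≤ Ring.jacobson A := le_sInf fun m hm => hall m hm
    exact hI.1 (le_bot_iff.1 (hJ ▸ hle))
  exact ⟨m, hI.not_le_iff_disjoint.1 hIm, (hm.not_le_iff_codisjoint.1 hIm).symm⟩

theorem isCompl_inf_sup_of_isCompl {α : Type*} [Lattice α] [BoundedOrder α] [IsModularLattice α]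
    {I m X L : α} (hIX : I ≤ X) (hm : IsCompl I m) (hX : IsCompl X L) :
    IsCompl (m ⊓ X) (I ⊔ L) := by
  have hsup : m ⊓ X ⊔ I = X := by
    rw [sup_comm, ← sup_inf_assoc_of_le m hIX, hm.sup_eq_top, top_inf_eq]
  exact (hm.disjoint.symm.mono_left inf_le_left).isCompl_sup_right_of_isCompl_sup_left
    (by rwa [hsup])

theorem exists_span_singleton_eq_of_isCompl {I L : Ideal A} (h : IsCompl I L) :
    ∃ e, Ideal.span {e} = I :=
  ⟨I.projection L h 1, by
    rw [← Ideal.submodule_span_eq, ← Set.image_singleton, ← LinearMap.map_span,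
      Ideal.submodule_span_eq, Ideal.span_singleton_one, Submodule.map_top,
      Submodule.range_projection]⟩

/-- A minimal principal left ideal with a semisimple complement vanishes, as it would otherwise
contain a minimal left ideal, to be moved to the complement. -/
theorem PrincipalLeftChainsStabilize.isSemisimpleRing (h : PrincipalLeftChainsStabilize A)
    (hJ : Ring.jacobson A = ⊥) : IsSemisimpleRing A := by
  have hbot : IsSemisimpleModule A (⊥ : Ideal A) :=
    (isSemisimpleModule_iff A _).2 Subsingleton.instComplementedLattice
  obtain ⟨x, ⟨L, hL, hxL⟩, hmin⟩ := h.wellFounded.has_min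
    {x | ∃ L : Ideal A, IsSemisimpleModule A L ∧ IsCompl (Ideal.span {x}) L}
    ⟨1, ⊥, hbot, by rw [Ideal.span_singleton_one]; exact isCompl_top_bot⟩
  by_cases hx : Ideal.span {x} = ⊥
  · rw [hx] at hxL
    obtain rfl : L = ⊤ := eq_top_of_bot_isCompl hxL
    exact IsSemisimpleModule.congr Submodule.topEquiv.symm
  obtain ⟨I, hIx, hI⟩ := h.exists_isAtom_le hx
  obtain ⟨m, hm⟩ := exists_isCompl_of_isAtom hJ hI
  have hcompl := isCompl_inf_sup_of_isCompl hIx hm hxL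
  obtain ⟨k, hk⟩ := exists_span_singleton_eq_of_isCompl hcompl
  have : IsSimpleModule A I := isSimpleModule_iff_isAtom.2 hI
  refine absurd ?_ (hmin k ⟨I ⊔ L, IsSemisimpleModule.sup inferInstance hL, hk ▸ hcompl⟩)
  rw [hk]
  refine inf_le_right.lt_of_not_ge fun hxm => hI.1 (le_bot_iff.1 (hm.disjoint le_rfl ?_))
  exact hIx.trans (hxm.trans inf_le_left)

theorem PrincipalLeftChainsStabilize.isRightPerfect (h : PrincipalLeftChainsStabilize R) :
    IsRightPerfect R where
  isSemisimpleRing := PrincipalLeftChainsStabilize.isSemisimpleRing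
    (h.of_surjective (φ := Ideal.Quotient.mk (Ring.jacobson R)) Ideal.Quotient.mk_surjective)
    (Ring.jacobson_quotient_jacobson R)
  rightTNilpotent a ha := by
    obtain ⟨n, hn⟩ := h a
    obtain ⟨r, hr⟩ := hn n le_rfl
    have hJ := ha n
    rw [← Ideal.jacobson_bot, Ideal.mem_jacobson_iff] at hJ
    obtain ⟨z, hz⟩ := hJ (-r)
    rw [Ideal.mem_bot, sub_eq_zero] at hz
    refine ⟨n, ?_⟩
    calc descendingProd a n = (z * -r * a n + z) * descendingProd a n := by rw [hz, one_mul]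
      _ = z * (descendingProd a n - r * descendingProd a (n + 1)) := by
        rw [descendingProd]; noncomm_ring
      _ = 0 := by rw [← hr, sub_self, mul_zero]

/-- The right annihilator `{x | I x = 0}` of a two-sided ideal `I`, as a left ideal. -/
def rightAnnihilator (I : Ideal R) [I.IsTwoSided] : Ideal R where
  carrier := {x | ∀ y ∈ I, y * x = 0}
  add_mem' hx hx' y hy := by rw [mul_add, hx y hy, hx' y hy, add_zero]
  zero_mem' y _ := mul_zero y
  smul_mem' s x hx y hy := by
    rw [smul_eq_mul, ← mul_assoc]
    exact hx _ (Ideal.mul_mem_right _ _ hy)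

theorem exists_descendingProd_notMem {I K : Ideal R} (hK : K ≠ ⊤)
    (h : ∀ x ∉ K, ∃ a ∈ I, a * x ∉ K) :
    ∃ a : ℕ → R, (∀ n, a n ∈ I) ∧ ∀ n, descendingProd a n ∉ K := by
  choose a haI ha using fun x : {x // x ∉ K} => h x.1 x.2
  let x : ℕ → {x // x ∉ K} :=
    fun n => Nat.rec ⟨1, (Ideal.ne_top_iff_one K).1 hK⟩ (fun _ x => ⟨a x * x.1, ha x⟩) n
  have hx (n : ℕ) : descendingProd (fun n => a (x n)) n = (x n).1 := by
    induction n with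
    | zero => rfl
    | succ n ih => rw [descendingProd, ih]
  exact ⟨fun n => a (x n), fun n => haI _, fun n => by rw [hx]; exact (x n).2⟩

theorem isNilpotent_of_rightTNilpotent [IsNoetherianRing R] {J : Ideal R} [J.IsTwoSided]
    (hJ : ∀ a : ℕ → R, (∀ n, a n ∈ J) → ∃ n, descendingProd a n = 0) : IsNilpotent J := by
  have hmono : Monotone fun k => rightAnnihilator (J ^ k) := fun k l hkl x hx y hy =>
    hx y (Ideal.pow_le_pow_right hkl hy)
  obtain ⟨n, hn⟩ := monotone_stabilizes_iff_noetherian.2 ‹IsNoetherianRing R› ⟨_, hmono⟩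
  refine ⟨n, ?_⟩
  by_contra hne
  have htop : rightAnnihilator (J ^ n) ≠ ⊤ := fun htop => hne <| le_bot_iff.1 fun y hy => by
    simpa using (Ideal.eq_top_iff_one _).1 htop y hy
  obtain ⟨a, haJ, ha⟩ := exists_descendingProd_notMem (I := J) htop fun x hx => by
    by_contra! hall
    refine hx ((hn (n + 1) n.le_succ).ge fun y hy => ?_)
    rw [Submodule.pow_succ] at hy
    induction hy using Submodule.mul_induction_on' with
    | mem_mul_mem p hp q hq => rw [mul_assoc]; exact hall q hq p hp
    | add p _ q _ hp hq => rw [add_mul, hp, hq, add_zero]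
  obtain ⟨k, hk⟩ := hJ a haJ
  exact ha k (hk ▸ zero_mem _)

theorem IsRightPerfect.isArtinianRing (h : IsRightPerfect R) [IsNoetherianRing R] :
    IsArtinianRing R :=
  have : IsSemiprimaryRing R :=
    ⟨h.isSemisimpleRing, isNilpotent_of_rightTNilpotent h.rightTNilpotent⟩
  IsSemiprimaryRing.isNoetherian_iff_isArtinian.1 ‹IsNoetherianRing R›

end Rings

section Bass

variable {R : Type u} [Ring R]

theorem leftExtOrthogonal_coker_telescope {E : Type u} [AddCommGroup E] [Module Rᵐᵒᵖ E]
    [Module.Free Rᵐᵒᵖ E] {f : ℕ → E →ₗ[Rᵐᵒᵖ] E} {X : Type u} [AddCommGroup X] [Module Rᵐᵒᵖ X]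
    {p : (ℕ →₀ E) →ₗ[Rᵐᵒᵖ] X} (hfp : Function.Exact (telescope f) p)
    (hp : Function.Surjective p) :
    leftExtOrthogonal (rightExtOrthogonal (flatMittagLefflerModules R)) (ModuleCat.of Rᵐᵒᵖ X) :=
  fun C hC => subsingleton_ext_of_exists_extension (C := C) (telescope_injective f) hfp hp
    fun g => exists_extension_telescope hC f g

/-- Left multiplication by `r` on the right module `R`. -/
abbrev leftMul (r : R) : Rᵐᵒᵖ →ₗ[Rᵐᵒᵖ] Rᵐᵒᵖ :=
  LinearMap.toSpanSingleton Rᵐᵒᵖ Rᵐᵒᵖ (MulOpposite.op r)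

/-- The direct limit of `R → R → ⋯` along the left multiplications by `a₀, a₁, …`. -/
abbrev BassModule (a : ℕ → R) : Type u :=
  (ℕ →₀ Rᵐᵒᵖ) ⧸ LinearMap.range (telescope fun n => leftMul (a n))

namespace BassModule

variable (a : ℕ → R)

/-- The image of `1` under the `n`-th canonical map from `R` to the Bass module. -/
noncomputable def generator (n : ℕ) : BassModule a := Submodule.Quotient.mk (Finsupp.single n 1)

theorem descendingProd_smul_generator (n : ℕ) :
    MulOpposite.op (descendingProd a n) • generator a n = generator a 0 := by
  induction n with
  | zero => exact one_smul _ _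
  | succ n ih =>
    rw [← ih, generator, generator, ← Submodule.Quotient.mk_smul, ← Submodule.Quotient.mk_smul]
    refine Eq.symm ((Submodule.Quotient.eq _).2 (LinearMap.mem_range.2
      ⟨Finsupp.single n (MulOpposite.op (descendingProd a n)), ?_⟩))
    simp [descendingProd]

variable {Q : Type*} [AddCommGroup Q] [Module R Q]

theorem finsuppLeft_mapLeft_telescope_zero (w : BalancedTensor R (ℕ →₀ Rᵐᵒᵖ) Q) :
    finsuppLeft R ℕ Q (mapLeft Q (telescope fun n => leftMul (a n)) w) 0 =
      finsuppLeft R ℕ Q w 0 := by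
  induction w using BalancedTensor.induction_on with
  | zero => simp
  | tmul k q => simp [telescope_apply_zero]
  | add x y hx hy => simp only [map_add, Finsupp.add_apply, hx, hy]

theorem finsuppLeft_mapLeft_telescope_succ (w : BalancedTensor R (ℕ →₀ Rᵐᵒᵖ) Q) (n : ℕ) :
    finsuppLeft R ℕ Q (mapLeft Q (telescope fun n => leftMul (a n)) w) (n + 1) =
      finsuppLeft R ℕ Q w (n + 1) - a n • finsuppLeft R ℕ Q w n := by
  induction w using BalancedTensor.induction_on with
  | zero => simp
  | tmul k q => simp [telescope_apply_succ, sub_smul, mul_smul]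
  | add x y hx hy =>
    simp only [map_add, Finsupp.add_apply, hx, hy, smul_add, add_sub_add_comm]

/-- A preimage of `e₀ ⊗ q` under the telescope has the coordinates `aₙ₋₁ ⋯ a₀ q`, and all but
finitely many of them vanish. -/
theorem generator_zero_tmul_eq_zero_iff (q : Q) :
    tmul R (generator a 0) q = 0 ↔ ∃ n, descendingProd a n • q = 0 := by
  refine ⟨fun h => ?_, fun ⟨n, hn⟩ => ?_⟩
  · obtain ⟨w, hw⟩ := (mapLeft_exact (N := Q)
      (LinearMap.exact_map_mkQ_range (telescope fun n => leftMul (a n)))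
      (Submodule.mkQ_surjective _) (tmul R (Finsupp.single 0 1) q)).1 h
    have hcoord (n : ℕ) : finsuppLeft R ℕ Q w n = descendingProd a n • q := by
      induction n with
      | zero =>
        rw [← finsuppLeft_mapLeft_telescope_zero a, hw, finsuppLeft_tmul, Finsupp.single_eq_same]
        rfl
      | succ n ih =>
        have hn := finsuppLeft_mapLeft_telescope_succ a w n
        rw [hw, finsuppLeft_tmul, Finsupp.single_eq_of_ne n.succ_ne_zero, ih] at hn
        rw [descendingProd, mul_smul, ← sub_eq_zero, ← hn]
        exact zero_smul R q
    obtain ⟨n, hn⟩ := Infinite.exists_notMem_finset (finsuppLeft R ℕ Q w).support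
    exact ⟨n, by rw [← hcoord, Finsupp.notMem_support_iff.1 hn]⟩
  · rw [← descendingProd_smul_generator a n, smul_tmul, hn, tmul_zero]

/-- The Mittag-Leffler condition is tested on `generator a 0 ⊗ (1 + R aₙ₋₁ ⋯ a₀)ₙ`. -/
theorem stabilizes {a : ℕ → R} (h : IsFlatML R (BassModule a)) :
    ∃ n, ∀ m ≥ n, ∃ r, descendingProd a m = r * descendingProd a (m + 1) := by
  let Q (i : ULift.{u} ℕ) : Type u := R ⧸ Ideal.span {descendingProd a i.down}
  let q (i : ULift.{u} ℕ) : Q i := Submodule.Quotient.mk 1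
  have hq (r : R) (i) : r • q i = 0 ↔ r ∈ Ideal.span {descendingProd a i.down} := by
    rw [← Submodule.Quotient.mk_smul, Submodule.Quotient.mk_eq_zero, smul_eq_mul, mul_one]
  have hzero : tmul R (generator a 0) q = 0 := by
    refine h _ (ULift ℕ) Q (fun i => LinearMap.proj i) (fun n hn => funext hn) _ fun i => ?_
    rw [map_tmul]
    exact (generator_zero_tmul_eq_zero_iff a _).2
      ⟨i.down, (hq _ _).2 (Ideal.mem_span_singleton_self _)⟩
  obtain ⟨n, hn⟩ := (generator_zero_tmul_eq_zero_iff a q).1 hzero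
  refine ⟨n, fun m hm => ?_⟩
  obtain ⟨t, ht⟩ : ∃ t, descendingProd a m = t * descendingProd a n := by
    induction m, hm using Nat.le_induction with
    | base => exact ⟨1, (one_mul _).symm⟩
    | succ m _ ih =>
      obtain ⟨t, ht⟩ := ih
      exact ⟨a m * t, by rw [descendingProd, ht, mul_assoc]⟩
  obtain ⟨s, hs⟩ := Ideal.mem_span_singleton'.1 ((hq _ ⟨m + 1⟩).1 (congrFun hn ⟨m + 1⟩))
  exact ⟨t * s, by rw [mul_assoc, hs, ht]⟩

end BassModule

theorem not_exists_eq_leftExtOrthogonal (hR : ¬ IsRightPerfect R) :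
    ¬ ∃ C : RightModuleClass R, flatMittagLefflerModules R = leftExtOrthogonal C := by
  rintro ⟨C, hC⟩
  refine hR (PrincipalLeftChainsStabilize.isRightPerfect fun a => BassModule.stabilizes
    ((flatMittagLefflerModules_iff (ModuleCat.of Rᵐᵒᵖ (BassModule a))).1 ?_))
  have hBass := leftExtOrthogonal_coker_telescope
    (LinearMap.exact_map_mkQ_range (telescope fun n => leftMul (a n)))
    (Submodule.mkQ_surjective _)
  rw [hC]
  exact fun N hN => hBass N fun M hM => (hC ▸ hM : leftExtOrthogonal C M) N hN

end Bass

section Products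

variable {R : Type u} [Ring R]

section

variable {J : Type*} {M : J → Type*} [∀ j, AddCommGroup (M j)] [∀ j, Module Rᵐᵒᵖ (M j)]

theorem eq_of_forall_mapLeft_proj_finsupp {Y : Type*}
    {v w : BalancedTensor R (∀ j, M j) (Y →₀ R)}
    (h : ∀ j, mapLeft (Y →₀ R) (LinearMap.proj j : (∀ j, M j) →ₗ[Rᵐᵒᵖ] M j) v =
      mapLeft (Y →₀ R) (LinearMap.proj j) w) : v = w := by
  refine (finsuppRight R _ Y).injective (Finsupp.ext fun y => funext fun j => ?_)
  have hj := DFunLike.congr_fun (congrArg (finsuppRight R (M j) Y) (h j)) y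
  rwa [finsuppRight_mapLeft, finsuppRight_mapLeft] at hj

theorem exists_mapLeft_proj_finsupp_eq {Y : Type*} [Finite Y]
    (w : ∀ j, BalancedTensor R (M j) (Y →₀ R)) :
    ∃ v : BalancedTensor R (∀ j, M j) (Y →₀ R), ∀ j, mapLeft _ (LinearMap.proj j) v = w j := by
  refine ⟨(finsuppRight R _ Y).symm
    (Finsupp.equivFunOnFinite.symm fun y j => finsuppRight R (M j) Y (w j) y), fun j => ?_⟩
  apply (finsuppRight R (M j) Y).injective
  ext y
  simp [finsuppRight_mapLeft]

theorem exists_exact_finsupp_of_finitePresentation (N : Type*) [AddCommGroup N] [Module R N]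
    [Module.FinitePresentation R N] :
    ∃ (s n : ℕ) (f : (Fin s →₀ R) →ₗ[R] (Fin n →₀ R)) (p : (Fin n →₀ R) →ₗ[R] N),
      Function.Exact f p ∧ Function.Surjective p := by
  obtain ⟨n, s, p, f, hp, hfp⟩ := Module.FinitePresentation.exists_fin' R N
  let e (k : ℕ) : (Fin k →₀ R) ≃ₗ[R] (Fin k → R) := Finsupp.linearEquivFunOnFinite R R (Fin k)
  refine ⟨s, n, (e n).symm ∘ₗ f ∘ₗ e s, p ∘ₗ e n, fun x => ?_, hp.comp (e n).surjective⟩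
  refine (hfp (e n x)).trans ⟨fun ⟨y, hy⟩ => ⟨(e s).symm y, by simp [hy]⟩, fun ⟨y, hy⟩ =>
    ⟨e s y, by simp [← hy]⟩⟩

theorem eq_zero_of_forall_mapLeft_proj {N : Type*} [AddCommGroup N] [Module R N]
    [Module.FinitePresentation R N] {z : BalancedTensor R (∀ j, M j) N}
    (hz : ∀ j, mapLeft N (LinearMap.proj j : (∀ j, M j) →ₗ[Rᵐᵒᵖ] M j) z = 0) : z = 0 := by
  obtain ⟨s, n, f, p, hfp, hp⟩ := exists_exact_finsupp_of_finitePresentation (R := R) N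
  obtain ⟨z, rfl⟩ := map_surjective hp z
  have hw (j) : ∃ w, BalancedTensor.map R (M j) f w = mapLeft _ (LinearMap.proj j) z :=
    (map_exact hfp hp _).1 (by rw [← mapLeft_map, hz])
  choose w hw using hw
  obtain ⟨v, hv⟩ := exists_mapLeft_proj_finsupp_eq w
  have hvz : BalancedTensor.map R _ f v = z :=
    eq_of_forall_mapLeft_proj_finsupp fun j => by rw [mapLeft_map, hv, hw]
  exact (map_exact hfp hp _).2 ⟨v, hvz⟩

end

theorem closedUnderProducts_of_isNoetherianRing [IsNoetherianRing R] :
    ClosedUnderProducts (flatMittagLefflerModules R) := by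
  intro J M hM
  refine (flatMittagLefflerModules_iff _).2 ?_
  simp only [flatMittagLefflerModules_iff] at hM
  intro N _ _ I Q _ _ g hg z hz
  obtain ⟨n, x, y, rfl⟩ := exists_eq_sum_tmul z
  let N₀ : Submodule R N := Submodule.span R (Set.range y)
  have : Module.Finite R N₀ := Module.Finite.span_of_finite R (Set.finite_range y)
  have : Module.FinitePresentation R N₀ := Module.finitePresentation_of_finite R N₀
  let z₀ : BalancedTensor R (∀ j, M j) N₀ :=
    ∑ k, tmul R (x k) ⟨y k, Submodule.subset_span ⟨k, rfl⟩⟩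
  have hz₀ : BalancedTensor.map R (∀ j, M j) N₀.subtype z₀ = ∑ k, tmul R (x k) (y k) := by
    simp [z₀]
  have hzero : z₀ = 0 := eq_zero_of_forall_mapLeft_proj fun j => by
    refine hM j N₀ I Q (fun i => g i ∘ₗ N₀.subtype) (fun n hn => Subtype.ext (hg _ hn)) _
      fun i => ?_
    rw [← mapLeft_map, ← map_map, hz₀, hz i, map_zero]
  change ∑ k, tmul R (x k) (y k) = 0
  rw [← hz₀, hzero, map_zero]

end Products

section CharacterModule

variable {R : Type*} [Ring R] {M N N' N'' : Type*} [AddCommGroup M] [Module Rᵐᵒᵖ M]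
  [AddCommGroup N] [Module R N] [AddCommGroup N'] [Module R N'] [AddCommGroup N''] [Module R N'']

/-- The right module structure on the character module of a left module. -/
instance characterModuleOp : Module Rᵐᵒᵖ (CharacterModule N) where
  smul r φ := AddMonoidHom.comp φ (DistribSMul.toAddMonoidHom N r.unop)
  one_smul φ := CharacterModule.ext _ fun n => congrArg φ (one_smul R n)
  mul_smul r s φ := CharacterModule.ext _ fun n => congrArg φ (mul_smul s.unop r.unop n)
  smul_zero _ := rfl
  smul_add _ _ _ := rfl
  add_smul r s φ := CharacterModule.ext _ fun n =>
    (congrArg φ (add_smul r.unop s.unop n)).trans (map_add φ _ _)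
  zero_smul φ := CharacterModule.ext _ fun n => (congrArg φ (zero_smul R n)).trans (map_zero φ)

/-- The right linear map of character modules induced by a left linear map. -/
def characterMap (f : N →ₗ[R] N') : CharacterModule N' →ₗ[Rᵐᵒᵖ] CharacterModule N where
  toFun φ := AddMonoidHom.comp φ f.toAddMonoidHom
  map_add' _ _ := rfl
  map_smul' r φ := CharacterModule.ext _ fun n => congrArg φ (f.map_smul r.unop n).symm

theorem characterMap_injective {f : N →ₗ[R] N'} (hf : Function.Surjective f) :
    Function.Injective (characterMap f) :=
  CharacterModule.dual_injective_of_surjective f.toAddMonoidHom.toIntLinearMap hf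

theorem characterMap_surjective {f : N →ₗ[R] N'} (hf : Function.Injective f) :
    Function.Surjective (characterMap f) :=
  CharacterModule.dual_surjective_of_injective f.toAddMonoidHom.toIntLinearMap hf

theorem characterMap_exact {f : N →ₗ[R] N'} {p : N' →ₗ[R] N''} (hfp : Function.Exact f p)
    (hp : Function.Surjective p) : Function.Exact (characterMap p) (characterMap f) := by
  refine fun φ => ⟨fun h => ?_, ?_⟩
  · have hker : p.toAddMonoidHom.ker ≤ AddMonoidHom.ker φ := fun n hn => by
      obtain ⟨m, rfl⟩ := (hfp n).1 hn
      exact DFunLike.congr_fun h m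
    exact ⟨p.toAddMonoidHom.liftOfSurjective hp ⟨φ, hker⟩, CharacterModule.ext _ <|
      p.toAddMonoidHom.liftOfRightInverse_comp_apply _ (Function.rightInverse_surjInv hp) ⟨φ, hker⟩⟩
  · rintro ⟨ψ, rfl⟩
    exact CharacterModule.ext _ fun n => (congrArg ψ (hfp.apply_apply_eq_zero n)).trans (map_zero ψ)

/-- The adjunction between `- ⊗_R N` and the formation of character modules. -/
def characterHomEquiv :
    (M →ₗ[Rᵐᵒᵖ] CharacterModule N) ≃ CharacterModule (BalancedTensor R M N) where
  toFun g := lift (show M →+ N →+ AddCircle (1 : ℚ) from g.toAddMonoidHom) fun m r n =>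
    DFunLike.congr_fun (g.map_smul (MulOpposite.op r) m) n
  invFun χ :=
    { toFun m := AddMonoidHom.mk' (fun n => χ (tmul R m n)) fun n n' => by rw [tmul_add, map_add]
      map_add' m m' := CharacterModule.ext _ fun n =>
        (congrArg χ (add_tmul m m' n)).trans (map_add χ _ _)
      map_smul' r m := CharacterModule.ext _ fun n => congrArg χ (smul_tmul m r.unop n) }
  left_inv _ := rfl
  right_inv _ := hom_ext fun _ _ => rfl

end CharacterModule

section Cotorsion

variable {R : Type u} [Ring R] {X : Type u} [AddCommGroup X] [Module Rᵐᵒᵖ X]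

theorem IsFlat.subsingleton_ext_characterModule (hX : IsFlat R X) (Q : Type u) [AddCommGroup Q]
    [Module R Q] :
    Subsingleton (Abelian.Ext (ModuleCat.of Rᵐᵒᵖ X) (ModuleCat.of Rᵐᵒᵖ (CharacterModule Q)) 1) := by
  let p : (X →₀ Rᵐᵒᵖ) →ₗ[Rᵐᵒᵖ] X := Finsupp.linearCombination Rᵐᵒᵖ (id : X → X)
  have hp : Function.Surjective p := Finsupp.linearCombination_id_surjective Rᵐᵒᵖ X
  have hi : Function.Injective (LinearMap.ker p).subtype := (LinearMap.ker p).injective_subtype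
  have hip : Function.Exact (LinearMap.ker p).subtype p := p.exact_subtype_ker_map
  refine subsingleton_ext_of_exists_extension (A := LinearMap.ker p) hi hip hp fun g => ?_
  obtain ⟨χ, hχ⟩ := CharacterModule.dual_surjective_of_injective
    (mapLeft Q (LinearMap.ker p).subtype).toIntLinearMap
    (hX.isPureMap_of_exact hi hip hp Q) (characterHomEquiv (M := LinearMap.ker p) g)
  exact ⟨characterHomEquiv.symm χ, LinearMap.ext fun a => CharacterModule.ext _ fun n =>
    DFunLike.congr_fun hχ (tmul R a n)⟩

theorem isFlat_of_subsingleton_ext_characterModule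
    (h : ∀ (Q : Type u) [AddCommGroup Q] [Module R Q],
      Subsingleton (Abelian.Ext (ModuleCat.of Rᵐᵒᵖ X) (ModuleCat.of Rᵐᵒᵖ (CharacterModule Q)) 1)) :
    IsFlat R X := by
  intro N N' _ _ _ _ f hf
  refine CharacterModule.dual_surjective_iff_injective (R := ℤ)
    (f := (BalancedTensor.map R X f).toIntLinearMap).1 fun χ => ?_
  have hp := (LinearMap.range f).mkQ_surjective
  obtain ⟨g, hg⟩ := exists_lift_of_subsingleton_ext (characterMap_injective hp)
    (characterMap_exact (LinearMap.exact_map_mkQ_range f) hp) (characterMap_surjective hf)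
    (h (N' ⧸ LinearMap.range f)) (characterHomEquiv.symm χ)
  exact ⟨characterHomEquiv g, hom_ext fun m n => DFunLike.congr_fun (LinearMap.congr_fun hg m) n⟩

theorem isFlat_of_mem_leftExtOrthogonal
    (hX : leftExtOrthogonal (rightExtOrthogonal (flatMittagLefflerModules R))
      (ModuleCat.of Rᵐᵒᵖ X)) : IsFlat R X :=
  isFlat_of_subsingleton_ext_characterModule fun Q _ _ => hX _ fun D hD =>
    ((flatMittagLefflerModules_iff D).1 hD).isFlat.subsingleton_ext_characterModule Q

end Cotorsion

section FlatQuotient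

variable {R : Type u} [Ring R] {M A B X : Type*} [AddCommGroup M] [Module Rᵐᵒᵖ M]
  [AddCommGroup A] [Module Rᵐᵒᵖ A] [AddCommGroup B] [Module Rᵐᵒᵖ B] [AddCommGroup X]
  [Module Rᵐᵒᵖ X]

theorem IsFlat.of_isPureMap {i : A →ₗ[Rᵐᵒᵖ] B} (hi : IsPureMap i) (hB : IsFlat R B) :
    IsFlat R A :=
  fun N _ _ _ _ _ f hf => (injective_iff_map_eq_zero _).2 fun z hz =>
    (map_eq_zero_iff _ (hi N)).1 <| (map_eq_zero_iff _ (hB _ _ f hf)).1 <| by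
      rw [← mapLeft_map, hz, map_zero]

theorem IsFlat.of_linearEquiv (e : A ≃ₗ[Rᵐᵒᵖ] B) (hB : IsFlat R B) : IsFlat R A :=
  IsFlat.of_isPureMap (isPureMap_linearEquiv e) hB

theorem IsFlat.of_exact_isPureMap (hB : IsFlat R B) {i : A →ₗ[Rᵐᵒᵖ] B} {p : B →ₗ[Rᵐᵒᵖ] X}
    (hi : IsPureMap i) (hip : Function.Exact i p) (hp : Function.Surjective p) : IsFlat R X := by
  refine fun N N' _ _ _ _ f hf => (injective_iff_map_eq_zero _).2 fun z hz => ?_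
  have hfq := LinearMap.exact_map_mkQ_range f
  have hq := (LinearMap.range f).mkQ_surjective
  -- Chase the grid with rows `A → B → X` and columns `N → N' → N' / N`.
  obtain ⟨b, rfl⟩ := mapLeft_surjective hp z
  rw [← mapLeft_map] at hz
  obtain ⟨a, ha⟩ := (mapLeft_exact hip hp _).1 hz
  have ha₀ : BalancedTensor.map R A (LinearMap.range f).mkQ a = 0 := by
    refine (map_eq_zero_iff _ (hi _)).1 ?_
    rw [mapLeft_map, ha]
    exact (map_exact hfq hq).apply_apply_eq_zero b
  obtain ⟨a, rfl⟩ := (map_exact hfq hq _).1 ha₀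
  rw [mapLeft_map] at ha
  rw [← hB _ _ f hf ha]
  exact (mapLeft_exact hip hp).apply_apply_eq_zero a

theorem isFlat_quotient_of_directed {ι : Type*} [Nonempty ι] {S : ι → Submodule Rᵐᵒᵖ M}
    {U : Submodule Rᵐᵒᵖ M} (hS : Directed (· ≤ ·) S) (hSU : ∀ i, S i ≤ U)
    (hU : ∀ x ∈ U, ∃ j, x ∈ S j) (hF : ∀ i, IsFlat R (M ⧸ S i)) : IsFlat R (M ⧸ U) := by
  refine fun N N' _ _ _ _ f hf => (injective_iff_map_eq_zero _).2 fun z hz => ?_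
  obtain ⟨z, rfl⟩ := mapLeft_surjective U.mkQ_surjective z
  rw [← mapLeft_map] at hz
  obtain ⟨w, hw⟩ := (mapLeft_exact (LinearMap.exact_subtype_mkQ U) U.mkQ_surjective _).1 hz
  obtain ⟨j, w, rfl⟩ := exists_mapLeft_inclusion_eq hS hSU hU w
  have hw' : mapLeft N' (S j).subtype w = BalancedTensor.map R M f z := by
    rw [← hw, mapLeft_mapLeft]
    rfl
  have hj : mapLeft N (S j).mkQ z = 0 := by
    refine (map_eq_zero_iff _ (hF j _ _ f hf)).1 ?_
    rw [← mapLeft_map, ← hw']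
    exact (mapLeft_exact (LinearMap.exact_subtype_mkQ (S j))
      (S j).mkQ_surjective).apply_apply_eq_zero w
  rw [← Submodule.factor_comp_mk (hSU j), ← mapLeft_mapLeft, hj, map_zero]

theorem isFlat_quotient_domain_sSup {c : Set (M →ₗ.[Rᵐᵒᵖ] X)} (hne : c.Nonempty)
    (hc : DirectedOn (· ≤ ·) c) (hF : ∀ h ∈ c, IsFlat R (M ⧸ h.domain)) :
    IsFlat R (M ⧸ (LinearPMap.sSup c hc).domain) := by
  have : Nonempty c := hne.to_subtype
  refine isFlat_quotient_of_directed (S := fun h : c => h.1.domain) (fun h h' => ?_)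
    (fun h => (LinearPMap.le_sSup hc h.2).1) (fun x hx => ?_) fun h => hF h h.2
  · obtain ⟨k, hk, hhk, hhk'⟩ := hc h.1 h.2 h'.1 h'.2
    exact ⟨⟨k, hk⟩, hhk.1, hhk'.1⟩
  · obtain ⟨h, hh, hx⟩ := (LinearPMap.mem_domain_sSup_iff hne hc).1 hx
    exact ⟨⟨h, hh⟩, hx⟩

end FlatQuotient

section CountablePure

variable {R : Type u} [Ring R] {M : Type*} [AddCommGroup M] [Module Rᵐᵒᵖ M]

/-- Equational purity of a submodule `W`: finite systems of linear equations with constants in `W`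
that are solvable in `M` are solvable in `W`. -/
def IsEquationallyPure (W : Submodule Rᵐᵒᵖ M) : Prop :=
  ∀ (p n : ℕ) (a : Fin p → Fin n → R) (b : Fin n → W),
    (∃ y : Fin p → M, ∀ i, ∑ j, MulOpposite.op (a j i) • y j = b i) →
    ∃ y : Fin p → W, ∀ i, ∑ j, MulOpposite.op (a j i) • y j = b i

theorem finsuppRight_sum_tmul {Y ι : Type*} (s : Finset ι) (y : ι → M) (h : ι → Y →₀ R) (c : Y) :
    finsuppRight R M Y (∑ j ∈ s, tmul R (y j) (h j)) c =
      ∑ j ∈ s, MulOpposite.op (h j c) • y j := by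
  simp only [map_sum, Finsupp.finsetSum_apply, finsuppRight_tmul]

theorem IsEquationallyPure.exists_sum_tmul_eq {W : Submodule Rᵐᵒᵖ M} (hW : IsEquationallyPure W)
    {Y : Type*} {p : ℕ} (h : Fin p → Y →₀ R) (z : BalancedTensor R W (Y →₀ R))
    (hz : ∃ y : Fin p → M, ∑ j, tmul R (y j) (h j) = mapLeft _ W.subtype z) :
    ∃ y : Fin p → W, ∑ j, tmul R (y j) (h j) = z := by
  classical
  obtain ⟨y, hy⟩ := hz
  let t : Finset Y := (Finset.univ.biUnion fun j => (h j).support) ∪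
    (finsuppRight R W Y z).support
  obtain ⟨y', hy'⟩ := hW p t.card (fun j i => h j (t.equivFin.symm i))
    (fun i => finsuppRight R W Y z (t.equivFin.symm i)) ⟨y, fun i => by
      rw [← finsuppRight_sum_tmul, hy, finsuppRight_mapLeft, Finsupp.mapRange_apply,
        Submodule.subtype_apply]⟩
  refine ⟨y', (finsuppRight R W Y).injective (Finsupp.ext fun c => ?_)⟩
  rw [finsuppRight_sum_tmul]
  by_cases hct : c ∈ t
  · simpa using hy' (t.equivFin ⟨c, hct⟩)
  · simp only [t, Finset.mem_union, Finset.mem_biUnion, Finset.mem_univ, true_and, not_or,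
      not_exists, Finsupp.notMem_support_iff] at hct
    simp [hct.1, hct.2]

theorem IsEquationallyPure.isPureMap_subtype {W : Submodule Rᵐᵒᵖ M} (hW : IsEquationallyPure W) :
    IsPureMap W.subtype := by
  refine fun N _ _ => (injective_iff_map_eq_zero _).2 fun z hz => ?_
  let π : (N →₀ R) →ₗ[R] N := Finsupp.linearCombination R id
  have hπ : Function.Surjective π := Finsupp.linearCombination_id_surjective R N
  obtain ⟨z, rfl⟩ := map_surjective hπ z
  rw [mapLeft_map] at hz
  obtain ⟨w, hw⟩ := (map_ker_subtype_exact hπ _).1 hz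
  obtain ⟨p, y, h, rfl⟩ := exists_eq_sum_tmul w
  obtain ⟨y, rfl⟩ := hW.exists_sum_tmul_eq (fun j => (h j : N →₀ R)) z
    ⟨y, by simpa only [map_sum, map_tmul, Submodule.subtype_apply] using hw⟩
  rw [map_sum]
  exact Finset.sum_eq_zero fun j _ => by
    rw [map_tmul, LinearMap.mem_ker.1 (h j).2, tmul_zero]

theorem exists_countable_solutions [Countable R] (W : Submodule Rᵐᵒᵖ M) [Countable W] :
    ∃ W' : Submodule Rᵐᵒᵖ M, W ≤ W' ∧ Countable W' ∧
      ∀ (p n : ℕ) (a : Fin p → Fin n → R) (b : Fin n → W),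
        (∃ y : Fin p → M, ∀ i, ∑ j, MulOpposite.op (a j i) • y j = b i) →
        ∃ y : Fin p → W', ∀ i, ∑ j, MulOpposite.op (a j i) • (y j : M) = b i := by
  have : Countable Rᵐᵒᵖ := MulOpposite.opEquiv.symm.injective.countable
  let System := Σ p n : ℕ, (Fin p → Fin n → R) × (Fin n → W)
  let Solves (t : System) (y : Fin t.1 → M) : Prop :=
    ∀ i, ∑ j, MulOpposite.op (t.2.2.1 j i) • y j = t.2.2.2 i
  have hsol (t : System) : ∃ y, (∃ y', Solves t y') → Solves t y := by
    by_cases h : ∃ y', Solves t y'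
    · exact ⟨h.choose, fun _ => h.choose_spec⟩
    · exact ⟨0, fun h' => absurd h' h⟩
  choose sol hsol using hsol
  let v : W ⊕ (Σ t : System, Fin t.1) → M := Sum.elim (fun w => w) fun q => sol q.1 q.2
  exact ⟨Submodule.span Rᵐᵒᵖ (Set.range v),
    fun w hw => Submodule.subset_span ⟨Sum.inl ⟨w, hw⟩, rfl⟩, inferInstance,
    fun p n a b h => ⟨fun j => ⟨sol ⟨p, n, a, b⟩ j,
      Submodule.subset_span ⟨Sum.inr ⟨⟨p, n, a, b⟩, j⟩, rfl⟩⟩, hsol ⟨p, n, a, b⟩ h⟩⟩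

theorem exists_countable_isEquationallyPure [Countable R] (x : M) :
    ∃ W : Submodule Rᵐᵒᵖ M, x ∈ W ∧ Countable W ∧ IsEquationallyPure W := by
  have : Countable Rᵐᵒᵖ := MulOpposite.opEquiv.symm.injective.countable
  choose next hle hcount hsol using fun W : {W : Submodule Rᵐᵒᵖ M // Countable W} =>
    have := W.2
    exists_countable_solutions W.1
  have h₀ : Countable (Submodule.span Rᵐᵒᵖ {x}) := by
    rw [← Set.range_const (ι := Unit)]
    infer_instance
  let W : ℕ → {W : Submodule Rᵐᵒᵖ M // Countable W} := fun k =>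
    Nat.rec ⟨_, h₀⟩ (fun _ W => ⟨next W, hcount W⟩) k
  have hmono : Monotone fun k => (W k).1 := monotone_nat_of_le_succ fun k => hle (W k)
  have hmem {m : M} : m ∈ ⨆ k, (W k).1 ↔ ∃ k, m ∈ (W k).1 :=
    Submodule.mem_iSup_of_directed _ hmono.directed_le
  refine ⟨⨆ k, (W k).1, hmem.2 ⟨0, Submodule.mem_span_singleton_self x⟩, ?_, fun p n a b h => ?_⟩
  · have : ((⨆ k, (W k).1 : Submodule Rᵐᵒᵖ M) : Set M).Countable := by
      rw [Submodule.coe_iSup_of_directed _ hmono.directed_le]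
      exact Set.countable_iUnion fun k => (W k).2
    exact this
  · choose k hk using fun i => hmem.1 (b i).2
    let K := Finset.univ.sup k
    have hK (i) : (b i : M) ∈ (W K).1 := hmono (Finset.le_sup (Finset.mem_univ i)) (hk i)
    obtain ⟨y, hy⟩ := hsol (W K) p n a (fun i => ⟨b i, hK i⟩) h
    refine ⟨fun j => ⟨y j, hmem.2 ⟨K + 1, (y j).2⟩⟩, fun i => Subtype.ext ?_⟩
    simpa using hy i

end CountablePure

section CountableFlat

variable {R : Type u} [Ring R] {F : Type*} [AddCommGroup F] [Module Rᵐᵒᵖ F]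

theorem IsFlat.exists_factorization_of_sum_smul_eq_zero (hF : IsFlat R F) {ι : Type u} [Fintype ι]
    {x : ι → F} {r : ι → R} (hr : ∑ i, MulOpposite.op (r i) • x i = 0) :
    ∃ (p : ℕ) (y : Fin p → F) (a : Fin p → ι → R),
      (∀ i, x i = ∑ j, MulOpposite.op (a j i) • y j) ∧ ∀ j, ∑ i, a j i * r i = 0 := by
  classical
  let φ : (ι →₀ R) →ₗ[R] R := Finsupp.linearCombination R r
  let z : BalancedTensor R F (ι →₀ R) := ∑ i, tmul R (x i) (Finsupp.single i 1)
  have hz : BalancedTensor.map R F φ z = 0 := by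
    have hterm (i : ι) : tmul R (x i) (r i) = tmul R (MulOpposite.op (r i) • x i) (1 : R) := by
      rw [smul_tmul, smul_eq_mul, mul_one]
    simp only [z, φ, map_sum, map_tmul, Finsupp.linearCombination_single, one_smul, hterm,
      ← sum_tmul, hr, zero_tmul]
  have hz' : BalancedTensor.map R F φ.rangeRestrict z = 0 := by
    refine (map_eq_zero_iff _ (hF _ _ _ (LinearMap.range φ).injective_subtype)).1 ?_
    rw [map_map]
    exact hz
  obtain ⟨w, hw⟩ := (map_ker_subtype_exact φ.surjective_rangeRestrict _).1 hz'
  obtain ⟨p, y, h, rfl⟩ := exists_eq_sum_tmul w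
  refine ⟨p, y, fun j i => (h j : ι →₀ R) i, fun i => ?_, fun j => ?_⟩
  · have hi := DFunLike.congr_fun (congrArg (finsuppRight R F ι) hw) i
    simp only [map_sum (BalancedTensor.map _ _ _), map_tmul, Submodule.subtype_apply, z,
      finsuppRight_sum_tmul] at hi
    simpa [Finsupp.single_apply, apply_ite MulOpposite.op, ite_smul] using hi.symm
  · have hj : φ (h j) = 0 := congrArg Subtype.val (LinearMap.mem_ker.1 (h j).2)
    rwa [Finsupp.linearCombination_apply, Finsupp.sum_fintype _ _ (by simp)] at hj

variable {Y : Type u} {π : (Y →₀ Rᵐᵒᵖ) →ₗ[Rᵐᵒᵖ] F}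

theorem IsFlat.exists_comp_eq_of_map_eq_zero (hF : IsFlat R F) (hπ : Function.Surjective π)
    {k : Y →₀ Rᵐᵒᵖ} (hk : π k = 0) :
    ∃ f : (Y →₀ Rᵐᵒᵖ) →ₗ[Rᵐᵒᵖ] (Y →₀ Rᵐᵒᵖ), π ∘ₗ f = π ∧ f k = 0 := by
  classical
  have hπk : ∑ i : k.support, MulOpposite.op (k i).unop • π (Finsupp.single ↑i 1) = 0 := by
    have hlin : Finsupp.linearCombination Rᵐᵒᵖ (fun i => π (Finsupp.single i 1)) = π := by
      ext i
      simp
    rw [← hk, ← hlin, Finsupp.linearCombination_apply, hlin]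
    exact Finset.sum_coe_sort k.support fun i => k i • π (Finsupp.single i 1)
  obtain ⟨p, y, a, hy, ha⟩ := hF.exists_factorization_of_sum_smul_eq_zero hπk
  choose y' hy' using fun j => hπ (y j)
  let v (i : Y) : Y →₀ Rᵐᵒᵖ := if hi : i ∈ k.support
    then ∑ j, MulOpposite.op (a j ⟨i, hi⟩) • y' j else Finsupp.single i 1
  refine ⟨Finsupp.linearCombination Rᵐᵒᵖ v, Finsupp.lhom_ext' fun i => LinearMap.ext_ring ?_, ?_⟩
  · simp only [LinearMap.comp_apply, Finsupp.lsingle_apply, Finsupp.linearCombination_single,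
      one_smul, v]
    split_ifs with hi
    · simp only [map_sum, map_smul, hy', hy ⟨i, hi⟩]
    · rfl
  · have hv (i : k.support) : k i • v i = ∑ j, MulOpposite.op (a j i * (k i).unop) • y' j := by
      simp only [v, dif_pos i.2, Finset.smul_sum, smul_smul]
      rfl
    rw [Finsupp.linearCombination_apply, Finsupp.sum, ← Finset.sum_coe_sort,
      Finset.sum_congr rfl fun i _ => hv i, Finset.sum_comm]
    refine Finset.sum_eq_zero fun j _ => ?_
    rw [← Finset.sum_smul, ← Finset.op_sum, ha, MulOpposite.op_zero, zero_smul]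

theorem IsFlat.exists_comp_eq_of_finset (hF : IsFlat R F) (hπ : Function.Surjective π)
    (s : Finset (Y →₀ Rᵐᵒᵖ)) :
    ∃ f : (Y →₀ Rᵐᵒᵖ) →ₗ[Rᵐᵒᵖ] (Y →₀ Rᵐᵒᵖ), π ∘ₗ f = π ∧ ∀ k ∈ s, π k = 0 → f k = 0 := by
  classical
  induction s using Finset.induction_on with
  | empty => exact ⟨LinearMap.id, rfl, by simp⟩
  | insert a s _ ih =>
    obtain ⟨f, hf, hfs⟩ := ih
    obtain ⟨g, hg, hga⟩ : ∃ g : (Y →₀ Rᵐᵒᵖ) →ₗ[Rᵐᵒᵖ] (Y →₀ Rᵐᵒᵖ), π ∘ₗ g = π ∧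
        (π a = 0 → g (f a) = 0) := by
      by_cases ha : π a = 0
      · obtain ⟨g, hg, hga⟩ := hF.exists_comp_eq_of_map_eq_zero hπ (k := f a)
          (by rw [← LinearMap.comp_apply, hf, ha])
        exact ⟨g, hg, fun _ => hga⟩
      · exact ⟨LinearMap.id, rfl, fun ha' => absurd ha' ha⟩
    refine ⟨g ∘ₗ f, by rw [← LinearMap.comp_assoc, hg, hf], fun k hk hk₀ => ?_⟩
    rcases Finset.mem_insert.1 hk with rfl | hk
    · exact hga hk₀
    · rw [LinearMap.comp_apply, hfs k hk hk₀, map_zero]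

end CountableFlat

section Transition

variable {S E F : Type*} [Ring S] [AddCommGroup E] [Module S E] [AddCommGroup F] [Module S F]

/-- The composite `f_{m+k-1} ∘ ⋯ ∘ f_m` of `k` consecutive maps of the sequence `f`. -/
def transition (f : ℕ → E →ₗ[S] E) (m : ℕ) : ℕ → E →ₗ[S] E
  | 0 => LinearMap.id
  | k + 1 => f (m + k) ∘ₗ transition f m k

theorem comp_transition {f : ℕ → E →ₗ[S] E} {π : E →ₗ[S] F} (hf : ∀ n, π ∘ₗ f n = π) (m k : ℕ) :
    π ∘ₗ transition f m k = π := by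
  induction k with
  | zero => rfl
  | succ k ih => rw [transition, ← LinearMap.comp_assoc, hf, ih]

theorem single_sub_single_transition_mem_range (f : ℕ → E →ₗ[S] E) (m k : ℕ) (x : E) :
    Finsupp.single m x - Finsupp.single (m + k) (transition f m k x) ∈
      LinearMap.range (telescope f) := by
  induction k with
  | zero =>
    rw [transition, LinearMap.id_apply, add_zero, sub_self]
    exact zero_mem _
  | succ k ih =>
    have hk := add_mem ih (LinearMap.mem_range_self (telescope f)
      (Finsupp.single (m + k) (transition f m k x)))
    rwa [telescope_single, sub_add_sub_cancel] at hk

theorem exists_sub_single_mem_range (f : ℕ → E →ₗ[S] E) (w : ℕ →₀ E) :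
    ∃ n x, w - Finsupp.single n x ∈ LinearMap.range (telescope f) := by
  induction w using Finsupp.induction_linear with
  | zero => exact ⟨0, 0, by simp⟩
  | single m x => exact ⟨m, x, by simp⟩
  | add u v hu hv =>
    obtain ⟨m, x, hx⟩ := hu
    obtain ⟨n, y, hy⟩ := hv
    refine ⟨m + n, transition f m n x + transition f n m y, ?_⟩
    have hx' := add_mem hx (single_sub_single_transition_mem_range f m n x)
    have hy' := add_mem hy (single_sub_single_transition_mem_range f n m y)
    rw [sub_add_sub_cancel] at hx' hy'
    rw [Finsupp.single_add, ← sub_add_sub_comm]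
    exact add_mem hx' (add_comm m n ▸ hy')

theorem exact_telescope {f : ℕ → E →ₗ[S] E} {π : E →ₗ[S] F} (hf : ∀ n, π ∘ₗ f n = π)
    (hker : ∀ m x, π x = 0 → ∃ k, transition f m k x = 0) :
    Function.Exact (telescope f) (Finsupp.lsum ℕ fun _ : ℕ => π) := by
  have hq (n : ℕ) (x : E) : Finsupp.lsum ℕ (fun _ : ℕ => π) (Finsupp.single n x) = π x := by simp
  have hqf : Finsupp.lsum ℕ (fun _ : ℕ => π) ∘ₗ telescope f = 0 :=
    Finsupp.lhom_ext fun n x => by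
      rw [LinearMap.comp_apply, telescope_single, map_sub, hq, hq, ← LinearMap.comp_apply, hf,
        sub_self, LinearMap.zero_apply]
  refine fun w => ⟨fun hw => ?_, fun ⟨c, hc⟩ => hc ▸ LinearMap.congr_fun hqf c⟩
  obtain ⟨n, x, c, hc⟩ := exists_sub_single_mem_range f w
  have hx : π x = 0 := by
    have h := LinearMap.congr_fun hqf c
    rwa [LinearMap.comp_apply, hc, map_sub, hw, hq, zero_sub, LinearMap.zero_apply,
      neg_eq_zero] at h
  obtain ⟨k, hk⟩ := hker n x hx
  have hnx := single_sub_single_transition_mem_range f n k x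
  rw [hk, Finsupp.single_zero, sub_zero] at hnx
  have hw' := add_mem (LinearMap.mem_range.2 ⟨c, hc⟩) hnx
  rwa [sub_add_cancel] at hw'

theorem exists_seq_transition_eq_zero [Countable E] {π : E →ₗ[S] F}
    (h : ∀ s : Finset E, ∃ f : E →ₗ[S] E, π ∘ₗ f = π ∧ ∀ k ∈ s, π k = 0 → f k = 0) :
    ∃ f : ℕ → E →ₗ[S] E, (∀ n, π ∘ₗ f n = π) ∧
      ∀ m x, π x = 0 → ∃ k, transition f m k x = 0 := by
  classical
  obtain ⟨e, he⟩ := exists_surjective_nat E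
  choose kill hkill hkill₀ using h
  let step (n : ℕ) (L : Finset (E →ₗ[S] E)) : E →ₗ[S] E :=
    kill ((L ×ˢ Finset.range (n + 1)).image fun q => q.1 (e q.2))
  -- `L n` consists of the maps `transition f m (n - m)` with `m ≤ n`.
  let L : ℕ → Finset (E →ₗ[S] E) := fun n => Nat.rec {LinearMap.id}
    (fun n L => insert LinearMap.id (L.image fun g => step n L ∘ₗ g)) n
  let f (n : ℕ) : E →ₗ[S] E := step n (L n)
  have hf (n : ℕ) : π ∘ₗ f n = π := hkill _
  have hL (m k : ℕ) : transition f m k ∈ L (m + k) := by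
    induction k with
    | zero =>
      cases m with
      | zero => exact Finset.mem_singleton_self _
      | succ m => exact Finset.mem_insert_self _ _
    | succ k ih => exact Finset.mem_insert_of_mem (Finset.mem_image_of_mem _ ih)
  refine ⟨f, hf, fun m x hx => ?_⟩
  obtain ⟨i, rfl⟩ := he x
  refine ⟨i + 1, hkill₀ _ _ (Finset.mem_image.2 ⟨(transition f m i, i),
    Finset.mem_product.2 ⟨hL m i, Finset.mem_range.2 (by lia)⟩, rfl⟩) ?_⟩
  rw [← LinearMap.comp_apply, comp_transition hf, hx]

end Transition

section CountableRing

variable {R : Type u} [Ring R] [Countable R]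

theorem IsFlat.leftExtOrthogonal_of_countable {F : Type u} [AddCommGroup F] [Module Rᵐᵒᵖ F]
    [Countable F] (hF : IsFlat R F) :
    leftExtOrthogonal (rightExtOrthogonal (flatMittagLefflerModules R))
      (ModuleCat.of Rᵐᵒᵖ F) := by
  have : Countable Rᵐᵒᵖ := MulOpposite.opEquiv.symm.injective.countable
  have hπ := Finsupp.linearCombination_id_surjective Rᵐᵒᵖ F
  obtain ⟨f, hf, hker⟩ := exists_seq_transition_eq_zero (hF.exists_comp_eq_of_finset hπ)
  refine leftExtOrthogonal_coker_telescope (exact_telescope hf hker) fun x => ?_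
  obtain ⟨y, rfl⟩ := hπ x
  exact ⟨Finsupp.single 0 y, by simp⟩

variable {P : Type u} [AddCommGroup P] [Module Rᵐᵒᵖ P] {C : ModuleCat.{u} Rᵐᵒᵖ}

theorem exists_extension_of_isFlat_quotient_of_mem {D : Submodule Rᵐᵒᵖ P} (hD : IsFlat R (P ⧸ D))
    (hC : rightExtOrthogonal (flatMittagLefflerModules R) C) (g : D →ₗ[Rᵐᵒᵖ] C) (x : P) :
    ∃ (D' : Submodule Rᵐᵒᵖ P) (h : D ≤ D') (g' : D' →ₗ[Rᵐᵒᵖ] C),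
      x ∈ D' ∧ IsFlat R (P ⧸ D') ∧ g' ∘ₗ Submodule.inclusion h = g := by
  obtain ⟨W, hxW, hWc, hW⟩ := exists_countable_isEquationallyPure (R := R) (D.mkQ x)
  have hle : D ≤ W.comap D.mkQ := D.ker_mkQ.symm.trans_le (LinearMap.ker_le_comap _)
  have hexact : Function.Exact (Submodule.inclusion hle) (D.mkQ.submoduleComap W) := fun d => by
    rw [← Submodule.coe_eq_zero, LinearMap.submoduleComap_apply_coe, Submodule.mkQ_apply,
      Submodule.Quotient.mk_eq_zero]
    exact ⟨fun hd => ⟨⟨d, hd⟩, rfl⟩, fun ⟨c, hc⟩ => hc ▸ c.2⟩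
  have hWF : IsFlat R W := IsFlat.of_isPureMap hW.isPureMap_subtype hD
  obtain ⟨g', hg'⟩ := exists_extension_of_subsingleton_ext (C := C)
    (Submodule.inclusion_injective hle) hexact
    (D.mkQ.submoduleComap_surjective_of_surjective W D.mkQ_surjective)
    (hWF.leftExtOrthogonal_of_countable C hC) g
  have hker : LinearMap.ker (W.mkQ ∘ₗ D.mkQ) = W.comap D.mkQ := by
    rw [LinearMap.ker_comp, Submodule.ker_mkQ]
  have e : (P ⧸ W.comap D.mkQ) ≃ₗ[Rᵐᵒᵖ] ((P ⧸ D) ⧸ W) :=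
    (Submodule.quotEquivOfEq _ _ hker.symm).trans
      ((W.mkQ ∘ₗ D.mkQ).quotKerEquivOfSurjective (W.mkQ_surjective.comp D.mkQ_surjective))
  have hflat : IsFlat R ((P ⧸ D) ⧸ W) := hD.of_exact_isPureMap hW.isPureMap_subtype
    (LinearMap.exact_subtype_mkQ W) W.mkQ_surjective
  exact ⟨W.comap D.mkQ, hle, g', hxW, IsFlat.of_linearEquiv e hflat, hg'⟩

theorem exists_extension_of_isFlat_quotient {D : Submodule Rᵐᵒᵖ P} (hD : IsFlat R (P ⧸ D))
    (hC : rightExtOrthogonal (flatMittagLefflerModules R) C) (g : D →ₗ[Rᵐᵒᵖ] C) :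
    ∃ g' : P →ₗ[Rᵐᵒᵖ] C, g' ∘ₗ D.subtype = g := by
  obtain ⟨m, hgm, hm, hmax⟩ := zorn_le_nonempty₀
    {h : P →ₗ.[Rᵐᵒᵖ] C | IsFlat R (P ⧸ h.domain)}
    (fun c hcF hc y hy => ⟨LinearPMap.sSup c hc.directedOn,
      isFlat_quotient_domain_sSup ⟨y, hy⟩ hc.directedOn hcF,
      fun z hz => LinearPMap.le_sSup hc.directedOn hz⟩) ⟨D, g⟩ hD
  have htop (x : P) : x ∈ m.domain := by
    obtain ⟨D', hle, g', hx, hD', hg'⟩ :=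
      exists_extension_of_isFlat_quotient_of_mem hm hC m.toFun x
    have hm' : m ≤ ⟨D', g'⟩ := ⟨hle, fun a b hab => by
      rw [show b = Submodule.inclusion hle a from Subtype.ext hab.symm]
      exact (LinearMap.congr_fun hg' a).symm⟩
    exact (hmax (y := ⟨D', g'⟩) hD' hm').1 hx
  refine ⟨m.toFun ∘ₗ LinearMap.codRestrict m.domain LinearMap.id htop, LinearMap.ext fun a => ?_⟩
  exact (hgm.2 (x := a) (y := ⟨a, htop a⟩) rfl).symm

theorem IsFlat.mem_leftExtOrthogonal {M : Type u} [AddCommGroup M] [Module Rᵐᵒᵖ M]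
    (hM : IsFlat R M) : leftExtOrthogonal (rightExtOrthogonal (flatMittagLefflerModules R))
      (ModuleCat.of Rᵐᵒᵖ M) := by
  intro C hC
  let p : (M →₀ Rᵐᵒᵖ) →ₗ[Rᵐᵒᵖ] M := Finsupp.linearCombination Rᵐᵒᵖ id
  have hp : Function.Surjective p := Finsupp.linearCombination_id_surjective Rᵐᵒᵖ M
  have hker : IsFlat R ((M →₀ Rᵐᵒᵖ) ⧸ LinearMap.ker p) :=
    IsFlat.of_linearEquiv (p.quotKerEquivOfSurjective hp) hM
  exact subsingleton_ext_of_exists_extension (A := LinearMap.ker p) (C := C)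
    (LinearMap.ker p).injective_subtype p.exact_subtype_ker_map hp
    fun g => exists_extension_of_isFlat_quotient hker hC g

end CountableRing

theorem leftExtOrthogonal_rightExtOrthogonal_eq_flatModules (R : Type u) [Ring R] [Countable R] :
    leftExtOrthogonal (rightExtOrthogonal (flatMittagLefflerModules R)) = flatModules R :=
  funext fun M => propext ⟨isFlat_of_mem_leftExtOrthogonal (X := M),
    IsFlat.mem_leftExtOrthogonal (M := M)⟩

theorem mainTheorem11_general (R : Type u) [Ring R] :
    ClosedUnderTransfiniteExtensions (flatMittagLefflerModules R) ∧
    (¬ IsRightPerfect R →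
      ¬ ∃ C : RightModuleClass R, flatMittagLefflerModules R = leftExtOrthogonal C) ∧
    (Countable R →
      leftExtOrthogonal (rightExtOrthogonal (flatMittagLefflerModules R)) = flatModules R) ∧
    (IsNoetherianRing R → ClosedUnderProducts (flatMittagLefflerModules R)) ∧
    (IsNoetherianRing R → IsRightPerfect R → IsArtinianRing R) :=
  ⟨closedUnderTransfiniteExtensions_flatMittagLefflerModules, not_exists_eq_leftExtOrthogonal,
    fun _ => leftExtOrthogonal_rightExtOrthogonal_eq_flatModules R,
    fun _ => closedUnderProducts_of_isNoetherianRing, fun _ hR => hR.isArtinianRing⟩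

theorem mainTheorem11 (R : Type u) [Ring R] :
    (¬ IsRightPerfect R → ClosedUnderProducts (flatMittagLefflerModules R) →
      ClosedUnderTransfiniteExtensions (flatMittagLefflerModules R) ∧
      ¬ ∃ C : RightModuleClass R, flatMittagLefflerModules R = leftExtOrthogonal C) ∧
    (Countable R → ClosedUnderProducts (flatMittagLefflerModules R) →
      leftExtOrthogonal (rightExtOrthogonal (flatMittagLefflerModules R)) = flatModules R) ∧
    (IsNoetherianRing R → ClosedUnderProducts (flatMittagLefflerModules R)) ∧
    (IsNoetherianRing R → ¬ IsArtinianRing R → ¬ IsRightPerfect R) := by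
  obtain ⟨htrans, hleft, hcountable, hprod, hartin⟩ := mainTheorem11_general R
  exact ⟨fun hR _ => ⟨htrans, hleft hR⟩, fun hR _ => hcountable hR, hprod,
    fun hN hA hR => hA (hartin hN hR)⟩
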